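/- There is an absolute constant $C>0$ such that the following holds. Let $n\ge 1$ and let $A$ be the adjacency matrix of a random graph drawn from the inhomogeneous Erdős–Rényi model $G(n,(p_{ij}))$, that is, $A$ is a random symmetric $n\times n$ matrix with entries in $\{0,1\}$ whose entries on and above the diagonal are independent, with $\mathbb{P}(A_{ij}=1)=p_{ij}$ for all $i,j$ (graphs without self-loops correspond to $p_{ii}=0$). Let $d=\max_{i,j} n p_{ij}$. For $\tau>0$ put $A_\tau=A+\frac{\tau}{n}\mathbf{1}\mathbf{1}^{\mathsf T}$, where $\mathbf 1$ is the all-ones vector. For a matrix $M$ with positive row sums $d_i=\sum_{j} M_{ij}$ let $\mathcal{L}(M)=D^{-1/2}MD^{-1/2}$ with $D=\operatorname{diag}(d_1,\dots,d_n)$, and let $\|\cdot\|$ be the spectral norm. Then for every $\tau>0$ and every $r\ge 1$, with probability at least $1-e^{-r}$, $$ \|\mathcal{L}(A_\tau)-\mathcal{L}(\mathbb{E}A_\tau)\|\le \frac{C r^2}{\sqrt{\tau}}\Big(1+\frac{d}{\tau}\Big)^{5/2}. $$ -/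

import Mathlib

open MeasureTheory ProbabilityTheory

noncomputable section

namespace RegLap

/-- The random matrix `A` is the adjacency matrix of a random graph on `n` vertices drawn from the
inhomogeneous Erdős–Rényi model `G(n, (p i j))`: it is symmetric with entries in `{0, 1}`, the
entries on and above the diagonal are independent, and `A i j = 1` with probability `p i j`.
Graphs without self-loops are the case `p i i = 0`. -/
structure IsInhomogeneousER {Ω : Type*} [MeasurableSpace Ω] (μ : Measure Ω) {n : ℕ}
    (p : Matrix (Fin n) (Fin n) ℝ) (A : Ω → Matrix (Fin n) (Fin n) ℝ) : Prop where
  measurable : ∀ i j, Measurable fun ω => A ω i j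
  binary : ∀ ω i j, A ω i j = 0 ∨ A ω i j = 1
  symm : ∀ ω, (A ω).IsSymm
  prob : ∀ i j, μ.real {ω | A ω i j = 1} = p i j
  indep : iIndepFun
    (fun (e : {e : Fin n × Fin n // e.1 ≤ e.2}) (ω : Ω) => A ω e.1.1 e.1.2) μ

/-- `d = max_{i,j} n p_{ij}`. -/
def maxDeg {n : ℕ} (p : Matrix (Fin n) (Fin n) ℝ) : ℝ :=
  ⨆ e : Fin n × Fin n, (n : ℝ) * p e.1 e.2

/-- The regularized matrix `M_τ = M + (τ / n) 1 1ᵀ`. -/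
def regularize {n : ℕ} (τ : ℝ) (M : Matrix (Fin n) (Fin n) ℝ) : Matrix (Fin n) (Fin n) ℝ :=
  M + (τ / n) • Matrix.vecMulVec 1 1

/-- The degree `d_i = ∑_j M_{ij}`. -/
def degree {n : ℕ} (M : Matrix (Fin n) (Fin n) ℝ) (i : Fin n) : ℝ := ∑ j, M i j

/-- The symmetric normalized Laplacian `D^{-1/2} M D^{-1/2}` with `D = diag(d_i)`. -/
def laplacian {n : ℕ} (M : Matrix (Fin n) (Fin n) ℝ) : Matrix (Fin n) (Fin n) ℝ :=
  Matrix.diagonal (fun i => degree M i ^ (-(1 / 2) : ℝ)) * M *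
    Matrix.diagonal (fun i => degree M i ^ (-(1 / 2) : ℝ))

/-- The entrywise expectation of a random matrix. -/
def expectation {Ω : Type*} [MeasurableSpace Ω] (μ : Measure Ω) {n : ℕ}
    (X : Ω → Matrix (Fin n) (Fin n) ℝ) : Matrix (Fin n) (Fin n) ℝ :=
  Matrix.of fun i j => ∫ ω, X ω i j ∂μ

/-- The spectral norm, that is, the operator norm on Euclidean space. -/
def specNorm {n : ℕ} (M : Matrix (Fin n) (Fin n) ℝ) : ℝ :=
  ‖Matrix.toEuclideanCLM (n := Fin n) (𝕜 := ℝ) M‖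

end RegLap

end

noncomputable section

namespace RegLap

/-! The normalized Laplacian does not need `A - p` to be small in spectral norm, which fails when
some degrees are atypically large. It only needs a bound `m ‖w‖_g ‖z‖_g` for the form of `A - p` in
norms weighted by `g i = 1 + degree A i / (18 r 4 ^ h)`, where `4 ^ h` is comparable to `d + τ` and
`m` to `r 2 ^ h` (`bilin_centered_le`). Because `τ g i ≤ degree A i + τ`, normalizing by the
regularized degrees absorbs the weights (`specNorm_laplacian_sub_le`): no high-degree vertex is
removed.

The weighted bound follows the Kahn–Szemerédi method. `bilin_le_of_lattice` reduces it to integer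
vectors `a`, `b`, and pairs are split by the size of `|a i b j|`. For light pairs, Chernoff and a
union bound over lattice points suffice (`measure_not_lightBound_le`). For heavy pairs, absolute
values are used: the mean part is small, and the random part is cut into dyadic levels. Comparable
levels are controlled by edge counts between vertex sets (`measure_not_discrepancy_le`,
`Discrepancy.sum_levels_le`); very unequal levels are controlled by degrees, hence by the weights
(`Discrepancy.sum_heavy_le`).

For `τ < 1` the claimed bound exceeds the trivial bound 2. For `τ ≥ 1` the argument yields `r` and
the exponent 3/2 in place of `r ^ 2` and 5/2. -/

/-- The bilinear form `xᵀ M y` of a matrix. -/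
def bilin {n : ℕ} (M : Matrix (Fin n) (Fin n) ℝ) (x y : Fin n → ℝ) : ℝ :=
  ∑ i, ∑ j, M i j * x i * y j

/-! ### Bilinear forms and reduction to integer vectors. -/

section Bilin

variable {n : ℕ} (M : Matrix (Fin n) (Fin n) ℝ)

lemma bilin_add_left (x x' y : Fin n → ℝ) :
    bilin M (x + x') y = bilin M x y + bilin M x' y := by
  simp only [bilin, ← Finset.sum_add_distrib, Pi.add_apply]
  exact Finset.sum_congr rfl fun i _ => Finset.sum_congr rfl fun j _ => by ring

lemma bilin_add_right (x y y' : Fin n → ℝ) :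
    bilin M x (y + y') = bilin M x y + bilin M x y' := by
  simp only [bilin, ← Finset.sum_add_distrib, Pi.add_apply]
  exact Finset.sum_congr rfl fun i _ => Finset.sum_congr rfl fun j _ => by ring

lemma bilin_smul_smul (c : ℝ) (x y : Fin n → ℝ) :
    bilin M (c • x) (c • y) = c ^ 2 * bilin M x y := by
  simp only [bilin, Finset.mul_sum, Pi.smul_apply, smul_eq_mul]
  exact Finset.sum_congr rfl fun i _ => Finset.sum_congr rfl fun j _ => by ring

lemma bilin_eq_inner (x y : EuclideanSpace ℝ (Fin n)) :
    bilin M x y = inner ℝ x (Matrix.toEuclideanCLM (n := Fin n) (𝕜 := ℝ) M y) := by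
  rw [Matrix.inner_toEuclideanCLM]
  simp only [bilin, dotProduct, Matrix.mulVec, Finset.mul_sum]
  exact Finset.sum_congr rfl fun i _ => Finset.sum_congr rfl fun j _ => by ring

lemma specNorm_nonneg : 0 ≤ specNorm M := norm_nonneg _

lemma bilin_le_specNorm (x y : Fin n → ℝ) :
    bilin M x y ≤ specNorm M * √(∑ i, x i ^ 2) * √(∑ i, y i ^ 2) := by
  have h := bilin_eq_inner M (WithLp.toLp 2 x) (WithLp.toLp 2 y)
  have h1 : bilin M x y ≤ ‖WithLp.toLp 2 x‖ * ‖Matrix.toEuclideanCLM (n := Fin n) (𝕜 := ℝ) M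
      (WithLp.toLp 2 y)‖ := by
    refine le_trans (le_of_eq h) (real_inner_le_norm _ _)
  have h2 := (Matrix.toEuclideanCLM (n := Fin n) (𝕜 := ℝ) M).le_opNorm (WithLp.toLp 2 y)
  have h3 : ‖WithLp.toLp 2 x‖ = √(∑ i, x i ^ 2) := by simp [EuclideanSpace.norm_eq]
  have h4 : ‖WithLp.toLp 2 y‖ = √(∑ i, y i ^ 2) := by simp [EuclideanSpace.norm_eq]
  rw [h3] at h1
  rw [h4] at h2
  calc bilin M x y ≤ _ := h1
    _ ≤ √(∑ i, x i ^ 2) * (specNorm M * √(∑ i, y i ^ 2)) := by gcongr; exact h2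
    _ = _ := by ring

variable {M}

lemma specNorm_le_of_bilin_le {c : ℝ} (hc : 0 ≤ c)
    (h : ∀ x y : Fin n → ℝ, ∑ i, x i ^ 2 ≤ 1 → ∑ i, y i ^ 2 ≤ 1 → bilin M x y ≤ c) :
    specNorm M ≤ c := by
  refine ContinuousLinearMap.opNorm_le_of_re_inner_le hc fun x y hx hy => ?_
  have hsq : ∀ z : EuclideanSpace ℝ (Fin n), ‖z‖ = 1 → ∑ i, z i ^ 2 ≤ 1 := by
    intro z hz
    have := EuclideanSpace.real_norm_sq_eq z
    rw [hz] at this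
    linarith
  have := h y x (hsq y hy) (hsq x hx)
  rw [bilin_eq_inner, real_inner_comm] at this
  simpa using this

/-- A bound for a matrix on the integer points of a weighted ball passes to all vectors. -/
lemma bilin_le_of_lattice {B : Matrix (Fin n) (Fin n) ℝ} {g : Fin n → ℝ} (hn : 1 ≤ n)
    (hg : ∀ i, 1 ≤ g i) (hsum : ∑ i, g i ≤ 2 * n) {Q : ℝ} (hQ : 0 ≤ Q)
    (h : ∀ a b : Fin n → ℤ, ∑ i, g i * (a i : ℝ) ^ 2 ≤ 36 * n → ∑ i, g i * (b i : ℝ) ^ 2 ≤ 36 * n →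
      bilin B (fun i => (a i : ℝ)) (fun i => (b i : ℝ)) ≤ 36 * n * Q) (w z : Fin n → ℝ) :
    bilin B w z ≤ 2 * Q * √(∑ i, g i * w i ^ 2) * √(∑ i, g i * z i ^ 2) := by
  have hn0 : (0 : ℝ) < n := by exact_mod_cast hn
  have hg0 : ∀ i, 0 < g i := fun i => lt_of_lt_of_le one_pos (hg i)
  have hs0 : ∀ i, 0 < √(g i) := fun i => Real.sqrt_pos.2 (hg0 i)
  have hss : ∀ i, √(g i) ^ 2 = g i := fun i => Real.sq_sqrt (hg0 i).le
  -- Rescaling by `√(g i)` turns the weighted norms into Euclidean ones, so the best constant is a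
  -- spectral norm.
  set M' : Matrix (Fin n) (Fin n) ℝ := Matrix.of fun i j => B i j / (√(g i) * √(g j)) with hM'
  have e1 : ∀ w z : Fin n → ℝ, bilin B w z =
      bilin M' (fun i => √(g i) * w i) (fun i => √(g i) * z i) := by
    intro w z
    simp only [bilin, hM', Matrix.of_apply]
    refine Finset.sum_congr rfl fun i _ => Finset.sum_congr rfl fun j _ => ?_
    have := (hs0 i).ne'
    have := (hs0 j).ne'
    field_simp
  have e2 : ∀ w z : Fin n → ℝ, bilin B w z ≤
      specNorm M' * √(∑ i, g i * w i ^ 2) * √(∑ i, g i * z i ^ 2) := by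
    intro w z
    rw [e1]
    refine (bilin_le_specNorm _ _ _).trans (le_of_eq ?_)
    simp only [mul_pow, hss]
  suffices hm : specNorm M' ≤ 2 * Q by
    refine (e2 w z).trans ?_
    gcongr
  have hm0 := specNorm_nonneg M'
  -- With mesh `1/η` the squared weighted rounding error is at most `(∑ g i) / η² ≤ 2n / (36n) =
  -- 1/18`, below `(1/4)²`.
  set η : ℝ := 6 * √n with hη
  have hη0 : 0 < η := by positivity
  have hη2 : η ^ 2 = 36 * n := by rw [hη, mul_pow, Real.sq_sqrt hn0.le]; norm_num
  -- rounding towards zero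
  have round : ∀ w : Fin n → ℝ, ∑ i, g i * w i ^ 2 ≤ 1 → ∃ a : Fin n → ℤ,
      ∑ i, g i * (a i : ℝ) ^ 2 ≤ 36 * n ∧
      √(∑ i, g i * (w i - η⁻¹ * a i) ^ 2) ≤ 1 / 4 := by
    intro w hw
    -- Truncation never increases `|t|`, so the rounded vector stays in the weighted ball where `h`
    -- applies.
    have key : ∀ t : ℝ, ∃ k : ℤ, (k : ℝ) ^ 2 ≤ t ^ 2 ∧ (t - k) ^ 2 ≤ 1 := by
      intro t
      rcases le_total 0 t with ht | ht
      · have h1 := Int.floor_le t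
        have h2 := Int.lt_floor_add_one t
        have h3 : (0 : ℝ) ≤ ⌊t⌋ := by exact_mod_cast Int.floor_nonneg.2 ht
        exact ⟨⌊t⌋, by nlinarith, by nlinarith⟩
      · have h1 := Int.le_ceil t
        have h2 := Int.ceil_lt_add_one t
        have h3 : ((⌈t⌉ : ℤ) : ℝ) ≤ 0 := by
          exact_mod_cast Int.ceil_le.2 (by simpa using ht)
        exact ⟨⌈t⌉, by nlinarith, by nlinarith⟩
    choose f hf1 hf2 using key
    refine ⟨fun i => f (η * w i), ?_, ?_⟩
    · calc ∑ i, g i * (f (η * w i) : ℝ) ^ 2 ≤ ∑ i, g i * (η * w i) ^ 2 :=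
            Finset.sum_le_sum fun i _ => mul_le_mul_of_nonneg_left (hf1 _) (hg0 i).le
        _ = η ^ 2 * ∑ i, g i * w i ^ 2 := by
            rw [Finset.mul_sum]; exact Finset.sum_congr rfl fun i _ => by ring
        _ ≤ η ^ 2 * 1 := by gcongr
        _ = 36 * n := by rw [hη2, mul_one]
    · rw [Real.sqrt_le_left (by norm_num)]
      calc ∑ i, g i * (w i - η⁻¹ * f (η * w i)) ^ 2
          = ∑ i, (η ^ 2)⁻¹ * (g i * (η * w i - f (η * w i)) ^ 2) := by
            refine Finset.sum_congr rfl fun i _ => ?_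
            field_simp
        _ ≤ ∑ i, (η ^ 2)⁻¹ * (g i * 1) := by
            refine Finset.sum_le_sum fun i _ => ?_
            have := hf2 (η * w i)
            have := (hg0 i).le
            gcongr
        _ = (η ^ 2)⁻¹ * ∑ i, g i := by simp [Finset.mul_sum]
        _ ≤ (36 * n : ℝ)⁻¹ * (2 * n) := by rw [hη2]; gcongr
        _ ≤ (1 / 4) ^ 2 := by
            rw [inv_mul_le_iff₀ (by positivity)]; linarith
  -- The two rounding errors each cost a quarter of the unknown norm, which is finite and can be
  -- absorbed on the left.
  have : specNorm M' ≤ Q + specNorm M' / 2 := by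
    refine specNorm_le_of_bilin_le (by positivity) fun x y hx hy => ?_
    set w : Fin n → ℝ := fun i => x i / √(g i) with hw
    set z : Fin n → ℝ := fun i => y i / √(g i) with hz
    have ex : (fun i => √(g i) * w i) = x := by
      funext i; have := (hs0 i).ne'; simp only [hw]; field_simp
    have ey : (fun i => √(g i) * z i) = y := by
      funext i; have := (hs0 i).ne'; simp only [hz]; field_simp
    have hx' : ∑ i, g i * w i ^ 2 ≤ 1 := by
      refine le_trans (le_of_eq (Finset.sum_congr rfl fun i _ => ?_)) hx
      rw [← ex]; simp only [mul_pow, hss]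
    have hy' : ∑ i, g i * z i ^ 2 ≤ 1 := by
      refine le_trans (le_of_eq (Finset.sum_congr rfl fun i _ => ?_)) hy
      rw [← ey]; simp only [mul_pow, hss]
    obtain ⟨a, ha1, ha2⟩ := round w hx'
    obtain ⟨b, hb1, hb2⟩ := round z hy'
    set aa : Fin n → ℝ := fun i => (a i : ℝ) with haa
    set bb : Fin n → ℝ := fun i => (b i : ℝ) with hbb
    have dw : w = η⁻¹ • aa + fun i => w i - η⁻¹ * a i := by
      funext i; simp [haa]
    have dz : z = η⁻¹ • bb + fun i => z i - η⁻¹ * b i := by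
      funext i; simp [hbb]
    have hsplit : bilin M' x y = (η⁻¹) ^ 2 * bilin B aa bb
        + bilin B (η⁻¹ • aa) (fun i => z i - η⁻¹ * b i) + bilin B (fun i => w i - η⁻¹ * a i) z := by
      rw [← bilin_smul_smul, ← bilin_add_right, ← dz, ← bilin_add_left, ← dw, e1, ex, ey]
    have t1 : (η⁻¹) ^ 2 * bilin B aa bb ≤ Q := by
      rw [inv_pow, inv_mul_le_iff₀ (by positivity), hη2]
      exact h a b ha1 hb1
    have na : √(∑ i, g i * (η⁻¹ • aa) i ^ 2) ≤ 1 := by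
      rw [Real.sqrt_le_one]
      calc ∑ i, g i * (η⁻¹ • aa) i ^ 2 = (η ^ 2)⁻¹ * ∑ i, g i * (a i : ℝ) ^ 2 := by
            rw [Finset.mul_sum]
            refine Finset.sum_congr rfl fun i _ => ?_
            simp only [haa, Pi.smul_apply, smul_eq_mul, mul_pow, inv_pow]; ring
        _ ≤ 1 := by
            rw [inv_mul_le_iff₀ (by positivity), hη2]; linarith
    have nz : √(∑ i, g i * z i ^ 2) ≤ 1 := by
      rwa [Real.sqrt_le_one]
    have t2 : bilin B (η⁻¹ • aa) (fun i => z i - η⁻¹ * b i) ≤ specNorm M' * 1 * (1 / 4) := by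
      refine (e2 _ _).trans ?_
      gcongr
    have t3 : bilin B (fun i => w i - η⁻¹ * a i) z ≤ specNorm M' * (1 / 4) * 1 := by
      refine (e2 _ _).trans ?_
      gcongr
    rw [hsplit]
    linarith
  linarith

end Bilin

/-! ### Entropy sums and weights of dyadic levels. -/

/-- The entropy bound `s log (e n / s)` for the logarithm of the number of `s`-subsets of an
`n`-set. -/
def ent (n s : ℕ) : ℝ := s * (1 + Real.log (n / s))

lemma ent_nonneg {n s : ℕ} (h : s ≤ n) : 0 ≤ ent n s := by
  rcases Nat.eq_zero_or_pos s with rfl | hs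
  · simp [ent]
  · have hs' : (0 : ℝ) < s := by exact_mod_cast hs
    have : (1 : ℝ) ≤ n / s := by
      rw [one_le_div hs']; exact_mod_cast h
    have := Real.log_nonneg this
    unfold ent
    positivity

/-- This is `log x ≤ x - 1` at `x = n y / s`; the free parameter `y` linearizes the entropy in `s`.
-/
lemma ent_le {n s : ℕ} (hn : 1 ≤ n) {y : ℝ} (hy : 0 < y) :
    ent n s ≤ n * y + s * Real.log y⁻¹ := by
  have hn0 : (0 : ℝ) < n := by exact_mod_cast hn
  rcases Nat.eq_zero_or_pos s with rfl | hs
  · simp only [ent, Nat.cast_zero, zero_mul, add_zero]; positivity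
  · have hs' : (0 : ℝ) < s := by exact_mod_cast hs
    have h1 := Real.log_le_sub_one_of_pos (show 0 < n / s * y by positivity)
    rw [Real.log_mul (by positivity) (by positivity)] at h1
    rw [Real.log_inv]
    have h2 : (s : ℝ) * (n / s * y) = n * y := by field_simp
    unfold ent
    nlinarith

/-- Apply `ent_le` with `y = 8 ^ (-l)`: the first term becomes the geometric series `n 2 ^ (-l)`,
and the factor `l log 8 ≤ 3 l` in the second is cancelled by the denominator `1 + l`. -/
lemma sum_ent_le {n : ℕ} (hn : 1 ≤ n) (t : ℕ → ℕ) (N : ℕ) :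
    ∑ l ∈ Finset.range N, 4 ^ l * ent n (t l) / (1 + l) ≤
      3 * ∑ l ∈ Finset.range N, (4 : ℝ) ^ l * t l + 2 * n := by
  have hn0 : (0 : ℝ) < n := by exact_mod_cast hn
  have hpt : ∀ l : ℕ, 4 ^ l * ent n (t l) / (1 + l) ≤
      3 * ((4 : ℝ) ^ l * t l) + n * (1 / 2) ^ l := by
    intro l
    have h1 := ent_le (s := t l) hn (show (0 : ℝ) < ((8 : ℝ) ^ l)⁻¹ by positivity)
    rw [inv_inv, Real.log_pow] at h1
    have h8 : Real.log 8 ≤ 3 := by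
      rw [show (8 : ℝ) = 2 ^ 3 by norm_num, Real.log_pow]
      have := Real.log_two_lt_d9
      push_cast; linarith
    have h2 : ent n (t l) ≤ n * ((8 : ℝ) ^ l)⁻¹ + t l * (l * 3) := h1.trans (by gcongr)
    rw [div_le_iff₀ (by positivity)]
    have h3 : (4 : ℝ) ^ l * ((8 : ℝ) ^ l)⁻¹ = (1 / 2) ^ l := by
      rw [← inv_pow, ← mul_pow]; norm_num
    calc 4 ^ l * ent n (t l) ≤ 4 ^ l * (n * ((8 : ℝ) ^ l)⁻¹ + t l * (l * 3)) := by gcongr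
      _ = n * (1 / 2) ^ l + 3 * ((4 : ℝ) ^ l * t l) * l := by rw [← h3]; ring
      _ ≤ (3 * ((4 : ℝ) ^ l * t l) + n * (1 / 2) ^ l) * (1 + l) := by
        have p1 : 0 ≤ 3 * ((4 : ℝ) ^ l * t l) := by positivity
        have p2 : 0 ≤ (n : ℝ) * (1 / 2) ^ l * l := by positivity
        nlinarith
  refine (Finset.sum_le_sum fun l _ => hpt l).trans ?_
  rw [Finset.sum_add_distrib, ← Finset.mul_sum, ← Finset.mul_sum]
  have := sum_geometric_two_le N
  nlinarith

lemma sum_two_pow_mul_le (m : ℕ) :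
    ∑ k ∈ Finset.range m, (2 : ℝ) ^ k * (2 + (m - k)) ≤ 4 * 2 ^ m := by
  induction m with
  | zero => simp
  | succ m ih =>
    rw [Finset.sum_range_succ]
    have h1 : ∑ k ∈ Finset.range m, (2 : ℝ) ^ k * (2 + ((m + 1 : ℕ) - k)) =
        ∑ k ∈ Finset.range m, (2 : ℝ) ^ k * (2 + (m - k)) + ∑ k ∈ Finset.range m, (2 : ℝ) ^ k := by
      rw [← Finset.sum_add_distrib]
      exact Finset.sum_congr rfl fun k _ => by push_cast; ring
    have h2 : ∑ k ∈ Finset.range m, (2 : ℝ) ^ k = 2 ^ m - 1 := by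
      rw [geom_sum_eq (by norm_num)]; ring
    rw [h1, h2]
    push_cast
    rw [pow_succ]
    linarith

/-- The weight with which the dyadic level `k` of one vector interacts with the level `l` of the
other. -/
def levelWeight (h k l : ℕ) : ℝ :=
  if h ≤ k + l ∧ k < l + h then (2 : ℝ) ^ k / (1 + ((k + l - h : ℕ) : ℝ) / 4) else 0

lemma levelWeight_nonneg (h k l : ℕ) : 0 ≤ levelWeight h k l := by
  unfold levelWeight
  split_ifs <;> positivity

/-- The sum is dominated by `k` near `l + h`. With `u = l + h - k` and `q = k + l - h` one has `u +
q = 2 l`, hence `(2 + u) (1 + q / 4) ≥ 1 + l`; this trades the denominator for `1 + l` at the cost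
of a factor linear in `u`, which the geometric decay absorbs. -/
lemma sum_levelWeight_le (h l N : ℕ) :
    ∑ k ∈ Finset.range N, levelWeight h k l ≤ 4 * 2 ^ (l + h) / (1 + l) := by
  simp only [levelWeight]
  have hpt : ∀ k, (if h ≤ k + l ∧ k < l + h then
      (2 : ℝ) ^ k / (1 + ((k + l - h : ℕ) : ℝ) / 4) else 0) ≤
      if k < l + h then (2 : ℝ) ^ k * (2 + ((l + h : ℕ) - k)) / (1 + l) else 0 := by
    intro k
    by_cases hk : k < l + h
    · have hk' : (k : ℝ) ≤ l + h := by exact_mod_cast hk.le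
      by_cases hk2 : h ≤ k + l
      · have hk3 : (h : ℝ) ≤ k + l := by exact_mod_cast hk2
        rw [if_pos ⟨hk2, hk⟩, if_pos hk, Nat.cast_sub hk2]
        push_cast
        rw [div_le_div_iff₀ (by linarith) (by positivity), mul_assoc]
        gcongr
        nlinarith [mul_nonneg (sub_nonneg.2 hk') (sub_nonneg.2 hk3)]
      · rw [if_neg (by tauto), if_pos hk]
        push_cast
        have : (0 : ℝ) ≤ 2 + (l + h - k) := by linarith
        positivity
    · rw [if_neg (by tauto), if_neg hk]
  refine (Finset.sum_le_sum fun k _ => hpt k).trans ?_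
  rw [← Finset.sum_filter]
  have hsub : (Finset.range N).filter (fun k => k < l + h) ⊆ Finset.range (l + h) := by
    intro k hk; simp at hk ⊢; exact hk.2
  refine (Finset.sum_le_sum_of_subset_of_nonneg hsub fun k hk _ => ?_).trans ?_
  · have hk' : (k : ℝ) ≤ (l + h : ℕ) := by exact_mod_cast (Finset.mem_range.1 hk).le
    have : (0 : ℝ) ≤ 2 + ((l + h : ℕ) - k) := by linarith
    positivity
  · rw [← Finset.sum_div]
    gcongr
    exact sum_two_pow_mul_le (l + h)

/-! ### Discrepancy and the heavy pairs. -/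

/-- Edge counts between vertex sets do not exceed their means by more than the entropy of the pair
of sets allows, simultaneously for a range of Chernoff parameters. -/
def Discrepancy {n : ℕ} (h : ℕ) (K : ℝ) (A : Matrix (Fin n) (Fin n) ℝ) : Prop :=
  ∀ S T : Finset (Fin n), ∀ q < n + 6,
    (1 + (q : ℝ) / 4) * ∑ i ∈ S, ∑ j ∈ T, A i j ≤
      S.card * T.card * (4 ^ h / n) * Real.exp (2 * (1 + (q : ℝ) / 4)) +
        K * (ent n S.card + ent n T.card)

/-- The set of indices `i` with `2 ^ k ≤ α i < 2 ^ (k + 1)`. -/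
def dyadicLevel {n : ℕ} (α : Fin n → ℕ) (k : ℕ) : Finset (Fin n) :=
  Finset.univ.filter fun i => α i ≠ 0 ∧ Nat.log 2 (α i) = k

lemma sum_four_pow_mul_card_dyadicLevel_le {n : ℕ} (α : Fin n → ℕ) (N : ℕ) :
    ∑ k ∈ Finset.range N, (4 : ℝ) ^ k * (dyadicLevel α k).card ≤ ∑ i, (α i : ℝ) ^ 2 := by
  have h1 : ∀ k, (4 : ℝ) ^ k * (dyadicLevel α k).card =
      ∑ i, if α i ≠ 0 ∧ Nat.log 2 (α i) = k then (4 : ℝ) ^ k else 0 := by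
    intro k
    rw [← Finset.sum_filter, Finset.sum_const, nsmul_eq_mul, mul_comm]
    rfl
  simp only [h1]
  rw [Finset.sum_comm]
  refine Finset.sum_le_sum fun i _ => ?_
  by_cases hi : α i = 0
  · simp [hi]
  · have h2 : (2 : ℝ) ^ Nat.log 2 (α i) ≤ α i := by exact_mod_cast Nat.pow_log_le_self 2 hi
    have h3 : (4 : ℝ) ^ Nat.log 2 (α i) ≤ (α i : ℝ) ^ 2 := by
      calc (4 : ℝ) ^ Nat.log 2 (α i) = (2 ^ Nat.log 2 (α i)) ^ 2 := by
            rw [← pow_mul, mul_comm, pow_mul]; norm_num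
        _ ≤ _ := by gcongr
    simp only [ne_eq, hi, not_false_eq_true, true_and, Finset.sum_ite_eq]
    split_ifs
    · exact h3
    · positivity

lemma two_pow_le_of_mem_dyadicLevel {n : ℕ} {α : Fin n → ℕ} {k : ℕ} {i : Fin n}
    (h : i ∈ dyadicLevel α k) : (2 : ℝ) ^ k ≤ α i := by
  simp only [dyadicLevel, Finset.mem_filter, Finset.mem_univ, true_and] at h
  rw [← h.2]
  exact_mod_cast Nat.pow_log_le_self 2 h.1

/-- Entries of vectors in the ball have product at most `36 n < 2 ^ (n + 6)`. Hence the finite range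
of `q` in `Discrepancy` covers all nonempty levels. -/
lemma dyadic_exponent_lt {n : ℕ} {α β : Fin n → ℕ} (hα : ∑ i, (α i : ℝ) ^ 2 ≤ 36 * n)
    (hβ : ∑ i, (β i : ℝ) ^ 2 ≤ 36 * n) {k l : ℕ} {i j : Fin n}
    (hi : (2 : ℝ) ^ k ≤ α i) (hj : (2 : ℝ) ^ l ≤ β j) : k + l < n + 6 := by
  have h1 : (α i : ℝ) ^ 2 ≤ 36 * n :=
    (Finset.single_le_sum (f := fun i => (α i : ℝ) ^ 2) (fun _ _ => by positivity)
      (Finset.mem_univ i)).trans hα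
  have h2 : (β j : ℝ) ^ 2 ≤ 36 * n :=
    (Finset.single_le_sum (f := fun i => (β i : ℝ) ^ 2) (fun _ _ => by positivity)
      (Finset.mem_univ j)).trans hβ
  have h3 : (2 : ℝ) ^ (k + l) ≤ 36 * n := by
    rw [pow_add]
    calc (2 : ℝ) ^ k * 2 ^ l ≤ α i * β j := by gcongr
      _ ≤ 36 * n := by nlinarith [sq_nonneg ((α i : ℝ) - β j)]
  have h4 : (n : ℝ) < 2 ^ n := by exact_mod_cast Nat.lt_two_pow_self
  have h5 : (2 : ℝ) ^ (k + l) < 2 ^ (n + 6) := by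
    rw [pow_add 2 n 6]; nlinarith
  exact (pow_lt_pow_iff_right₀ (by norm_num)).1 h5

/-- The Chernoff parameter is `1 + q / 4` with `q = k + l - h`. Its exponential costs at most `8 * 2
^ q`, exactly what turns the mean term into a multiple of `4 ^ k * 4 ^ l`, while the entropy term
gains the factor `1 / (1 + q / 4)`. -/
lemma Discrepancy.sum_dyadicLevel_le {n : ℕ} {h : ℕ} {K : ℝ} {A : Matrix (Fin n) (Fin n) ℝ}
    (hK : 0 ≤ K) (hd : Discrepancy h K A) {α β : Fin n → ℕ}
    (hα : ∑ i, (α i : ℝ) ^ 2 ≤ 36 * n) (hβ : ∑ i, (β i : ℝ) ^ 2 ≤ 36 * n) {k l : ℕ}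
    (hkl : h ≤ k + l) :
    2 ^ (k + l) * ∑ i ∈ dyadicLevel α k, ∑ j ∈ dyadicLevel β l, A i j ≤
      8 * 2 ^ h / n * ((4 ^ k * (dyadicLevel α k).card) * (4 ^ l * (dyadicLevel β l).card)) +
      K * (2 ^ (k + l) / (1 + ((k + l - h : ℕ) : ℝ) / 4)) *
        (ent n (dyadicLevel α k).card + ent n (dyadicLevel β l).card) := by
  have hcard : ∀ S : Finset (Fin n), S.card ≤ n := fun S => by simpa using S.card_le_univ
  set S := dyadicLevel α k
  set T := dyadicLevel β l
  have e1 := ent_nonneg (hcard S)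
  have e2 := ent_nonneg (hcard T)
  set q := k + l - h with hq
  set L : ℝ := 1 + (q : ℝ) / 4 with hL
  have hL1 : 1 ≤ L := by rw [hL]; linarith [show (0 : ℝ) ≤ (q : ℝ) / 4 by positivity]
  by_cases hne : S.Nonempty ∧ T.Nonempty
  · obtain ⟨⟨i, hi⟩, j, hj⟩ := hne
    have hlt := dyadic_exponent_lt hα hβ (two_pow_le_of_mem_dyadicLevel hi)
      (two_pow_le_of_mem_dyadicLevel hj)
    have hdis := hd S T q (by omega)
    have hexp : Real.exp (2 * L) ≤ 8 * 2 ^ q := by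
      have h1 : Real.exp 1 < 2.7182818286 := Real.exp_one_lt_d9
      have h2 : Real.exp (1 / 2) ≤ 2 := by
        have : Real.exp (1 / 2) ^ 2 = Real.exp 1 := by
          rw [← Real.exp_nat_mul]; norm_num
        nlinarith [Real.exp_pos (1 / 2)]
      have h3 : Real.exp 2 ≤ 8 := by
        have : Real.exp 2 = Real.exp 1 ^ 2 := by rw [← Real.exp_nat_mul]; norm_num
        nlinarith [Real.exp_pos 1]
      have h4 : Real.exp (2 * L) = Real.exp 2 * Real.exp (1 / 2) ^ q := by
        rw [← Real.exp_nat_mul, ← Real.exp_add, hL]; congr 1; ring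
      rw [h4]
      gcongr
    have hpow : (2 : ℝ) ^ (k + l) * 4 ^ h * 2 ^ q = 2 ^ h * (4 ^ k * 4 ^ l) := by
      have : (2 : ℝ) ^ q * 2 ^ h = 2 ^ (k + l) := by rw [← pow_add]; congr 1; omega
      have h4 : ∀ m : ℕ, (4 : ℝ) ^ m = 2 ^ m * 2 ^ m := fun m => by
        rw [← mul_pow]; norm_num
      rw [h4 h, h4 k, h4 l]
      calc (2 : ℝ) ^ (k + l) * (2 ^ h * 2 ^ h) * 2 ^ q
          = 2 ^ h * (2 ^ (k + l) * (2 ^ q * 2 ^ h)) := by ring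
        _ = _ := by rw [this, pow_add]; ring
    have hE : ∑ i ∈ S, ∑ j ∈ T, A i j ≤ S.card * T.card * (4 ^ h / n) * (8 * 2 ^ q) +
        K * (ent n S.card + ent n T.card) / L := by
      have hb : 0 ≤ S.card * T.card * ((4 : ℝ) ^ h / n) * (8 * 2 ^ q) := by positivity
      have : L * ∑ i ∈ S, ∑ j ∈ T, A i j ≤ L * (S.card * T.card * (4 ^ h / n) * (8 * 2 ^ q) +
        K * (ent n S.card + ent n T.card) / L) := by
        rw [mul_add, mul_div_cancel₀ _ (by positivity)]
        refine hdis.trans (add_le_add ?_ le_rfl)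
        calc _ ≤ S.card * T.card * ((4 : ℝ) ^ h / n) * (8 * 2 ^ q) := by gcongr
          _ ≤ _ := le_mul_of_one_le_left hb hL1
      exact le_of_mul_le_mul_left this (by positivity)
    calc _ ≤ 2 ^ (k + l) * (S.card * T.card * (4 ^ h / n) * (8 * 2 ^ q) +
        K * (ent n S.card + ent n T.card) / L) := by gcongr
      _ = 8 / n * S.card * T.card * (2 ^ (k + l) * 4 ^ h * 2 ^ q) +
        K * (2 ^ (k + l) / L) * (ent n S.card + ent n T.card) := by ring
      _ = _ := by rw [hpow]; ring
  · have h0 : ∑ i ∈ S, ∑ j ∈ T, A i j = 0 := by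
      by_cases hS : S.Nonempty
      · have : T = ∅ := Finset.not_nonempty_iff_eq_empty.1 fun hT => hne ⟨hS, hT⟩
        simp [this]
      · simp [Finset.not_nonempty_iff_eq_empty.1 hS]
    rw [h0, mul_zero]
    positivity

lemma sum_ent_mul_levelWeight_le {n : ℕ} (hn : 1 ≤ n) (h : ℕ) {K : ℝ} (hK : 0 ≤ K) (N : ℕ)
    (u : ℕ → ℕ) (hu0 : ∀ k, 0 ≤ ent n (u k))
    (hu : ∑ l ∈ Finset.range N, (4 : ℝ) ^ l * u l ≤ 36 * n) :
    ∑ l ∈ Finset.range N, ∑ k ∈ Finset.range N, K * (2 ^ l * ent n (u l) * levelWeight h k l) ≤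
      440 * K * 2 ^ h * n := by
  calc ∑ l ∈ Finset.range N, ∑ k ∈ Finset.range N, K * (2 ^ l * ent n (u l) * levelWeight h k l)
      = ∑ l ∈ Finset.range N,
          K * (2 ^ l * ent n (u l)) * ∑ k ∈ Finset.range N, levelWeight h k l := by
        simp only [Finset.mul_sum, mul_assoc]
    _ ≤ ∑ l ∈ Finset.range N, K * (2 ^ l * ent n (u l)) * (4 * 2 ^ (l + h) / (1 + l)) := by
        refine Finset.sum_le_sum fun l _ => mul_le_mul_of_nonneg_left (sum_levelWeight_le h l N) ?_
        have := hu0 l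
        positivity
    _ = 4 * K * 2 ^ h * ∑ l ∈ Finset.range N, 4 ^ l * ent n (u l) / (1 + l) := by
        rw [Finset.mul_sum]
        refine Finset.sum_congr rfl fun l _ => ?_
        rw [show (4 : ℝ) ^ l = 2 ^ l * 2 ^ l by rw [← mul_pow]; norm_num, pow_add]
        ring
    _ ≤ 4 * K * 2 ^ h * (3 * (36 * n) + 2 * n) := by
        gcongr
        refine (sum_ent_le hn u N).trans ?_
        gcongr
    _ = _ := by ring

/-- The contribution of the comparable dyadic levels. -/
lemma Discrepancy.sum_levels_le {n : ℕ} (hn : 1 ≤ n) {h : ℕ} {K : ℝ}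
    {A : Matrix (Fin n) (Fin n) ℝ} (hK : 0 ≤ K) (hd : Discrepancy h K A) {α β : Fin n → ℕ}
    (hα : ∑ i, (α i : ℝ) ^ 2 ≤ 36 * n) (hβ : ∑ i, (β i : ℝ) ^ 2 ≤ 36 * n) (N : ℕ) :
    ∑ k ∈ Finset.range N, ∑ l ∈ Finset.range N,
      (if h ≤ k + l ∧ k < l + h ∧ l < k + h then
        2 ^ (k + l) * ∑ i ∈ dyadicLevel α k, ∑ j ∈ dyadicLevel β l, A i j else 0) ≤
      (10368 + 880 * K) * 2 ^ h * n := by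
  have hn0 : (0 : ℝ) < n := by exact_mod_cast hn
  have hcard : ∀ S : Finset (Fin n), S.card ≤ n := fun S => by simpa using S.card_le_univ
  set s : ℕ → ℕ := fun k => (dyadicLevel α k).card with hs
  set t : ℕ → ℕ := fun k => (dyadicLevel β k).card with ht
  have hes : ∀ k, 0 ≤ ent n (s k) := fun k => ent_nonneg (hcard _)
  have het : ∀ k, 0 ≤ ent n (t k) := fun k => ent_nonneg (hcard _)
  have hpt : ∀ k l, (if h ≤ k + l ∧ k < l + h ∧ l < k + h then
        2 ^ (k + l) * ∑ i ∈ dyadicLevel α k, ∑ j ∈ dyadicLevel β l, A i j else 0) ≤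
      8 * 2 ^ h / n * ((4 ^ k * s k) * (4 ^ l * t l)) +
      (K * (2 ^ k * ent n (s k) * levelWeight h l k) +
        K * (2 ^ l * ent n (t l) * levelWeight h k l)) := by
    intro k l
    have a1 := hes k
    have a2 := het l
    have a3 := levelWeight_nonneg h k l
    have a4 := levelWeight_nonneg h l k
    split_ifs with hc
    · refine (hd.sum_dyadicLevel_le hK hα hβ hc.1).trans (le_of_eq ?_)
      have e1 : levelWeight h k l = (2 : ℝ) ^ k / (1 + ((k + l - h : ℕ) : ℝ) / 4) :=
        if_pos ⟨hc.1, hc.2.1⟩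
      have e2 : levelWeight h l k = (2 : ℝ) ^ l / (1 + ((k + l - h : ℕ) : ℝ) / 4) := by
        rw [levelWeight, if_pos ⟨by omega, hc.2.2⟩, add_comm l k]
      rw [e1, e2, pow_add]
      ring
    · positivity
  have hs' : ∑ l ∈ Finset.range N, (4 : ℝ) ^ l * s l ≤ 36 * n :=
    (sum_four_pow_mul_card_dyadicLevel_le α N).trans hα
  have ht' : ∑ l ∈ Finset.range N, (4 : ℝ) ^ l * t l ≤ 36 * n :=
    (sum_four_pow_mul_card_dyadicLevel_le β N).trans hβ
  refine (Finset.sum_le_sum fun k _ => Finset.sum_le_sum fun l _ => hpt k l).trans ?_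
  simp only [Finset.sum_add_distrib]
  -- The mean terms factor into a product of two level sums, each at most `36 n`; `10368 = 8 * 36 ^
  -- 2`.
  have b1 : ∑ k ∈ Finset.range N, ∑ l ∈ Finset.range N,
      8 * 2 ^ h / n * (((4 : ℝ) ^ k * s k) * (4 ^ l * t l)) ≤ 10368 * 2 ^ h * n := by
    simp only [← Finset.mul_sum]
    rw [← Finset.sum_mul]
    refine (mul_le_mul_of_nonneg_left (mul_le_mul hs' ht' (Finset.sum_nonneg fun l _ => by positivity)
      (by positivity)) (by positivity)).trans (le_of_eq ?_)
    rw [div_mul_eq_mul_div, div_eq_iff hn0.ne']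
    ring
  have b2 := sum_ent_mul_levelWeight_le hn h hK N s hes hs'
  have b3 := sum_ent_mul_levelWeight_le hn h hK N t het ht'
  rw [Finset.sum_comm] at b3
  linarith

/-- The contribution to `∑ A i j α i β j` of the pairs with a large product `α i β j`. -/
lemma Discrepancy.sum_heavy_le {n : ℕ} (hn : 1 ≤ n) {h : ℕ} {K D : ℝ}
    {A : Matrix (Fin n) (Fin n) ℝ} (hA : ∀ i j, 0 ≤ A i j) (hK : 0 ≤ K)
    (hd : Discrepancy h K A) {α β : Fin n → ℕ}
    (hα : ∑ i, (α i : ℝ) ^ 2 ≤ 36 * n) (hβ : ∑ i, (β i : ℝ) ^ 2 ≤ 36 * n)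
    (hAα : ∑ i, ∑ j, A i j * (α i : ℝ) ^ 2 ≤ D) (hAβ : ∑ i, ∑ j, A i j * (β j : ℝ) ^ 2 ≤ D) :
    ∑ i, ∑ j, (if 4 * 2 ^ h < α i * β j then A i j * (α i * β j : ℝ) else 0) ≤
      4 * D / 2 ^ h + 4 * ((10368 + 880 * K) * 2 ^ h * n) := by
  set N := n + 6
  have hpt : ∀ i j, (if 4 * 2 ^ h < α i * β j then A i j * (α i * β j : ℝ) else 0) ≤
      2 / 2 ^ h * (A i j * (α i : ℝ) ^ 2) + 2 / 2 ^ h * (A i j * (β j : ℝ) ^ 2) +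
      4 * ∑ k ∈ Finset.range N, ∑ l ∈ Finset.range N,
        (if h ≤ k + l ∧ k < l + h ∧ l < k + h then 2 ^ (k + l) *
          (if i ∈ dyadicLevel α k ∧ j ∈ dyadicLevel β l then A i j else 0) else 0) := by
    intro i j
    have hAij := hA i j
    have hnn : ∀ k l, (0 : ℝ) ≤ (if h ≤ k + l ∧ k < l + h ∧ l < k + h then 2 ^ (k + l) *
          (if i ∈ dyadicLevel α k ∧ j ∈ dyadicLevel β l then A i j else 0) else 0) := by
      intro k l
      split_ifs <;> positivity
    have hS : (0 : ℝ) ≤ ∑ k ∈ Finset.range N, ∑ l ∈ Finset.range N,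
        (if h ≤ k + l ∧ k < l + h ∧ l < k + h then 2 ^ (k + l) *
          (if i ∈ dyadicLevel α k ∧ j ∈ dyadicLevel β l then A i j else 0) else 0) :=
      Finset.sum_nonneg fun k _ => Finset.sum_nonneg fun l _ => hnn k l
    by_cases hheavy : 4 * 2 ^ h < α i * β j
    swap
    · rw [if_neg hheavy]; positivity
    rw [if_pos hheavy]
    have ha0 : α i ≠ 0 := by rintro h0; simp [h0] at hheavy
    have hb0 : β j ≠ 0 := by rintro h0; simp [h0] at hheavy
    set k := Nat.log 2 (α i) with hk
    set l := Nat.log 2 (β j) with hl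
    have k1 : 2 ^ k ≤ α i := Nat.pow_log_le_self 2 ha0
    have k2 : α i < 2 ^ (k + 1) := Nat.lt_pow_succ_log_self (by norm_num) _
    have l1 : 2 ^ l ≤ β j := Nat.pow_log_le_self 2 hb0
    have l2 : β j < 2 ^ (l + 1) := Nat.lt_pow_succ_log_self (by norm_num) _
    -- The factor 4 in the threshold pays for replacing both entries by their dyadic upper bounds.
    have hhkl : h ≤ k + l := by
      have : 2 ^ (h + 2) < 2 ^ (k + 1 + (l + 1)) := by
        rw [pow_add 2 (k + 1)]
        calc 2 ^ (h + 2) = 4 * 2 ^ h := by ring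
          _ < α i * β j := hheavy
          _ ≤ _ := Nat.mul_le_mul k2.le l2.le
      have := (Nat.pow_lt_pow_iff_right (by norm_num)).1 this
      omega
    have k1' : (2 : ℝ) ^ k ≤ α i := by exact_mod_cast k1
    have l1' : (2 : ℝ) ^ l ≤ β j := by exact_mod_cast l1
    have k2' : (α i : ℝ) ≤ 2 * 2 ^ k := by
      have : (α i : ℝ) ≤ 2 ^ (k + 1) := by exact_mod_cast k2.le
      rwa [pow_succ, mul_comm] at this
    have l2' : (β j : ℝ) ≤ 2 * 2 ^ l := by
      have : (β j : ℝ) ≤ 2 ^ (l + 1) := by exact_mod_cast l2.le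
      rwa [pow_succ, mul_comm] at this
    have hβnn : (0 : ℝ) ≤ 2 / 2 ^ h * (A i j * (β j : ℝ) ^ 2) := by positivity
    have hαnn : (0 : ℝ) ≤ 2 / 2 ^ h * (A i j * (α i : ℝ) ^ 2) := by positivity
    -- If one entry exceeds the other by a factor of order `2 ^ h`, the product is at most `2 / 2 ^
    -- h` times the larger square, and the sum of `A i j` against that square is a degree sum
    -- bounded by `D`.
    rcases le_or_gt (l + h) k with hc1 | hc1
    · have : (β j : ℝ) ≤ 2 / 2 ^ h * α i := by
        rw [div_mul_eq_mul_div, le_div_iff₀ (by positivity)]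
        calc (β j : ℝ) * 2 ^ h ≤ 2 * 2 ^ l * 2 ^ h := by gcongr
          _ = 2 * 2 ^ (l + h) := by rw [pow_add]; ring
          _ ≤ 2 * 2 ^ k := by gcongr; norm_num
          _ ≤ 2 * α i := by gcongr
      have : A i j * (α i * β j : ℝ) ≤ A i j * (α i * (2 / 2 ^ h * α i)) := by gcongr
      nlinarith
    rcases le_or_gt (k + h) l with hc2 | hc2
    · have : (α i : ℝ) ≤ 2 / 2 ^ h * β j := by
        rw [div_mul_eq_mul_div, le_div_iff₀ (by positivity)]
        calc (α i : ℝ) * 2 ^ h ≤ 2 * 2 ^ k * 2 ^ h := by gcongr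
          _ = 2 * 2 ^ (k + h) := by rw [pow_add]; ring
          _ ≤ 2 * 2 ^ l := by gcongr; norm_num
          _ ≤ 2 * β j := by gcongr
      have : A i j * (α i * β j : ℝ) ≤ A i j * ((2 / 2 ^ h * β j) * β j) := by gcongr
      nlinarith
    have hlt := dyadic_exponent_lt hα hβ k1' l1'
    have hkm : k ∈ Finset.range N := Finset.mem_range.2 (by omega)
    have hlm : l ∈ Finset.range N := Finset.mem_range.2 (by omega)
    have hterm : (2 : ℝ) ^ (k + l) * A i j ≤ ∑ k ∈ Finset.range N, ∑ l ∈ Finset.range N,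
        (if h ≤ k + l ∧ k < l + h ∧ l < k + h then 2 ^ (k + l) *
          (if i ∈ dyadicLevel α k ∧ j ∈ dyadicLevel β l then A i j else 0) else 0) := by
      refine le_trans ?_ (Finset.single_le_sum
        (fun k _ => Finset.sum_nonneg fun l _ => hnn k l) hkm)
      refine le_trans ?_ (Finset.single_le_sum (fun l _ => hnn k l) hlm)
      rw [if_pos ⟨hhkl, hc1, hc2⟩, if_pos]
      simp [dyadicLevel, ha0, hb0, hk, hl]
    have : A i j * (α i * β j : ℝ) ≤ 4 * (2 ^ (k + l) * A i j) := by
      calc A i j * (α i * β j : ℝ) ≤ A i j * ((2 * 2 ^ k) * (2 * 2 ^ l)) := by gcongr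
        _ = _ := by rw [pow_add]; ring
    linarith
  refine (Finset.sum_le_sum fun i _ => Finset.sum_le_sum fun j _ => hpt i j).trans ?_
  simp only [Finset.sum_add_distrib, ← Finset.mul_sum]
  have hswap : ∑ i, ∑ j, ∑ k ∈ Finset.range N, ∑ l ∈ Finset.range N,
        (if h ≤ k + l ∧ k < l + h ∧ l < k + h then (2 : ℝ) ^ (k + l) *
          (if i ∈ dyadicLevel α k ∧ j ∈ dyadicLevel β l then A i j else 0) else 0) =
      ∑ k ∈ Finset.range N, ∑ l ∈ Finset.range N,
      (if h ≤ k + l ∧ k < l + h ∧ l < k + h then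
        2 ^ (k + l) * ∑ i ∈ dyadicLevel α k, ∑ j ∈ dyadicLevel β l, A i j else 0) := by
    calc _ = ∑ i, ∑ k ∈ Finset.range N, ∑ l ∈ Finset.range N, ∑ j,
        (if h ≤ k + l ∧ k < l + h ∧ l < k + h then (2 : ℝ) ^ (k + l) *
          (if i ∈ dyadicLevel α k ∧ j ∈ dyadicLevel β l then A i j else 0) else 0) := by
          refine Finset.sum_congr rfl fun i _ => ?_
          rw [Finset.sum_comm]
          exact Finset.sum_congr rfl fun k _ => Finset.sum_comm
      _ = ∑ k ∈ Finset.range N, ∑ l ∈ Finset.range N, ∑ i, ∑ j,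
        (if h ≤ k + l ∧ k < l + h ∧ l < k + h then (2 : ℝ) ^ (k + l) *
          (if i ∈ dyadicLevel α k ∧ j ∈ dyadicLevel β l then A i j else 0) else 0) := by
          rw [Finset.sum_comm]
          exact Finset.sum_congr rfl fun k _ => Finset.sum_comm
      _ = _ := by
          refine Finset.sum_congr rfl fun k _ => Finset.sum_congr rfl fun l _ => ?_
          split_ifs
          · simp only [← Finset.mul_sum]
            congr 1
            simp only [ite_and]
            rw [← Finset.sum_filter_add_sum_filter_not Finset.univ (· ∈ dyadicLevel α k)]
            simp [Finset.sum_ite_mem, Finset.filter_not]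
          · simp
  rw [hswap]
  have h1 := hd.sum_levels_le hn hK hα hβ N
  have h2 : 2 / 2 ^ h * ∑ i, ∑ j, A i j * (α i : ℝ) ^ 2 ≤ 2 / 2 ^ h * D := by gcongr
  have h3 : 2 / 2 ^ h * ∑ i, ∑ j, A i j * (β j : ℝ) ^ 2 ≤ 2 / 2 ^ h * D := by gcongr
  have h4 : 4 * D / 2 ^ h = 2 / 2 ^ h * D + 2 / 2 ^ h * D := by ring
  linarith

/-! ### Exponential moments of linear statistics. -/

lemma sum_eq_sum_upper {n : ℕ} (f : Fin n → Fin n → ℝ) :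
    ∑ i, ∑ j, f i j = ∑ e : {e : Fin n × Fin n // e.1 ≤ e.2},
      (f e.1.1 e.1.2 + if e.1.1 < e.1.2 then f e.1.2 e.1.1 else 0) := by
  rw [← Fintype.sum_prod_type', ← Finset.sum_filter_add_sum_filter_not Finset.univ
    (fun x : Fin n × Fin n => x.1 ≤ x.2), Finset.sum_add_distrib]
  congr 1
  · exact Finset.sum_subtype _ (by simp) (fun x : Fin n × Fin n => f x.1 x.2)
  · rw [← Finset.sum_subtype (Finset.univ.filter fun x : Fin n × Fin n => x.1 ≤ x.2) (by simp)
      (fun x : Fin n × Fin n => if x.1 < x.2 then f x.2 x.1 else 0), ← Finset.sum_filter,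
      Finset.filter_filter]
    refine Finset.sum_nbij' Prod.swap Prod.swap ?_ ?_ ?_ ?_ ?_
    · simp +contextual [le_of_lt]
    · simp +contextual
    · simp
    · simp
    · simp

/-- AM-GM for `exp u` and `exp v`. It decouples the coefficients of the two copies of one edge in a
symmetric matrix, and is the source of the factor 2 in the exponents below. -/
lemma exp_add_sub_one_sub_le (u v : ℝ) :
    Real.exp (u + v) - 1 - (u + v) ≤
      (Real.exp (2 * u) - 1 - 2 * u) / 2 + (Real.exp (2 * v) - 1 - 2 * v) / 2 := by
  have h1 : Real.exp (2 * u) = Real.exp u ^ 2 := by rw [← Real.exp_nat_mul]; norm_num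
  have h2 : Real.exp (2 * v) = Real.exp v ^ 2 := by rw [← Real.exp_nat_mul]; norm_num
  rw [h1, h2, Real.exp_add]
  nlinarith [sq_nonneg (Real.exp u - Real.exp v)]

namespace IsInhomogeneousER

variable {Ω : Type*} [MeasurableSpace Ω] {μ : Measure Ω} {n : ℕ}
  {p : Matrix (Fin n) (Fin n) ℝ} {A : Ω → Matrix (Fin n) (Fin n) ℝ}

lemma entry_nonneg (hA : IsInhomogeneousER μ p A) (ω : Ω) (i j : Fin n) : 0 ≤ A ω i j := by
  rcases hA.binary ω i j with h | h <;> rw [h]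
  norm_num

lemma entry_le_one (hA : IsInhomogeneousER μ p A) (ω : Ω) (i j : Fin n) : A ω i j ≤ 1 := by
  rcases hA.binary ω i j with h | h <;> rw [h]
  norm_num

lemma prob_nonneg (hA : IsInhomogeneousER μ p A) (i j : Fin n) : 0 ≤ p i j := by
  rw [← hA.prob i j]; exact measureReal_nonneg

lemma prob_symm (hA : IsInhomogeneousER μ p A) (i j : Fin n) : p i j = p j i := by
  rw [← hA.prob i j, ← hA.prob j i]
  congr 1
  ext ω
  simp only [Set.mem_ofPred_eq, (hA.symm ω).apply i j]

lemma integral_entry (hA : IsInhomogeneousER μ p A) (i j : Fin n) :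
    ∫ ω, A ω i j ∂μ = p i j := by
  have h1 : (fun ω => A ω i j) = Set.indicator {ω | A ω i j = 1} 1 := by
    funext ω
    rcases hA.binary ω i j with h | h <;> simp [Set.indicator, h]
  have hm : MeasurableSet {ω | A ω i j = 1} := hA.measurable i j (measurableSet_singleton 1)
  rw [h1, integral_indicator_one hm, ← hA.prob i j]

variable [IsProbabilityMeasure μ]

lemma integrable_entry (hA : IsInhomogeneousER μ p A) (i j : Fin n) :
    Integrable (fun ω => A ω i j) μ :=
  Integrable.of_bound (hA.measurable i j).aestronglyMeasurable 1 (.of_forall fun ω => by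
    rw [Real.norm_eq_abs, abs_of_nonneg (hA.entry_nonneg ω i j)]; exact hA.entry_le_one ω i j)

lemma mgf_entry_le (hA : IsInhomogeneousER μ p A) (i j : Fin n) (c : ℝ) :
    mgf (fun ω => c * A ω i j) μ 1 ≤ Real.exp (p i j * (Real.exp c - 1)) := by
  have h1 : (fun ω => Real.exp (1 * (c * A ω i j))) =
      fun ω => 1 + A ω i j * (Real.exp c - 1) := by
    funext ω
    rcases hA.binary ω i j with h | h <;> simp [h]
  rw [mgf, h1, integral_add (integrable_const 1) ((hA.integrable_entry i j).mul_const _),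
    integral_mul_const, hA.integral_entry]
  simp only [integral_const, probReal_univ, smul_eq_mul, mul_one]
  linarith [Real.add_one_le_exp (p i j * (Real.exp c - 1))]

lemma mgf_sum_upper_le (hA : IsInhomogeneousER μ p A)
    (c : {e : Fin n × Fin n // e.1 ≤ e.2} → ℝ) :
    ∫ ω, Real.exp (∑ e, c e * A ω e.1.1 e.1.2) ∂μ ≤
      Real.exp (∑ e, p e.1.1 e.1.2 * (Real.exp (c e) - 1)) := by
  have hind : iIndepFun (fun (e : {e : Fin n × Fin n // e.1 ≤ e.2}) (ω : Ω) =>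
      c e * A ω e.1.1 e.1.2) μ :=
    hA.indep.comp (fun e x => c e * x) fun e => measurable_const_mul (c e)
  have h := hind.mgf_sum (t := 1) (fun e => (hA.measurable _ _).const_mul _) Finset.univ
  have h2 : mgf (∑ e, fun ω => c e * A ω e.1.1 e.1.2) μ 1 =
      ∫ ω, Real.exp (∑ e, c e * A ω e.1.1 e.1.2) ∂μ := by
    simp [mgf, Finset.sum_apply]
  rw [← h2, h, Real.exp_sum]
  exact Finset.prod_le_prod (fun e _ => mgf_nonneg) fun e _ => hA.mgf_entry_le _ _ _

lemma integral_exp_le (hA : IsInhomogeneousER μ p A) (c : Fin n → Fin n → ℝ) :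
    ∫ ω, Real.exp (∑ i, ∑ j, c i j * (A ω i j - p i j)) ∂μ ≤
      Real.exp (∑ i, ∑ j, p i j * ((Real.exp (2 * c i j) - 1 - 2 * c i j) / 2)) := by
  set u : {e : Fin n × Fin n // e.1 ≤ e.2} → ℝ := fun e => c e.1.1 e.1.2 with hu
  set v : {e : Fin n × Fin n // e.1 ≤ e.2} → ℝ :=
    fun e => if e.1.1 < e.1.2 then c e.1.2 e.1.1 else 0 with hv
  have h1 : ∀ ω, ∑ i, ∑ j, c i j * (A ω i j - p i j) =
      ∑ e, (u e + v e) * A ω e.1.1 e.1.2 + -∑ e, (u e + v e) * p e.1.1 e.1.2 := by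
    intro ω
    rw [sum_eq_sum_upper, ← Finset.sum_neg_distrib, ← Finset.sum_add_distrib]
    refine Finset.sum_congr rfl fun e _ => ?_
    simp only [hu, hv]
    rw [(hA.symm ω).apply e.1.1 e.1.2, hA.prob_symm e.1.2 e.1.1]
    split_ifs <;> ring
  simp only [h1, Real.exp_add _ (-_), integral_mul_const]
  refine (mul_le_mul_of_nonneg_right (hA.mgf_sum_upper_le _) (Real.exp_pos _).le).trans ?_
  rw [← Real.exp_add, Real.exp_le_exp, sum_eq_sum_upper, ← Finset.sum_neg_distrib,
    ← Finset.sum_add_distrib]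
  refine Finset.sum_le_sum fun e _ => ?_
  have h2 := mul_le_mul_of_nonneg_left (exp_add_sub_one_sub_le (u e) (v e))
    (hA.prob_nonneg e.1.1 e.1.2)
  have h3 : p e.1.1 e.1.2 * ((Real.exp (2 * v e) - 1 - 2 * v e) / 2) =
      if e.1.1 < e.1.2 then p e.1.2 e.1.1 *
        ((Real.exp (2 * c e.1.2 e.1.1) - 1 - 2 * c e.1.2 e.1.1) / 2) else 0 := by
    simp only [hv]
    rw [hA.prob_symm e.1.2 e.1.1]
    split_ifs <;> simp
  rw [← h3]
  linarith

lemma integrable_exp (hA : IsInhomogeneousER μ p A) (c : Fin n → Fin n → ℝ) :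
    Integrable (fun ω => Real.exp (∑ i, ∑ j, c i j * (A ω i j - p i j))) μ := by
  refine Integrable.of_bound (C := Real.exp (∑ i, ∑ j, |c i j| * (1 + p i j))) ?_
    (.of_forall fun ω => ?_)
  · refine Measurable.aestronglyMeasurable (Measurable.exp ?_)
    refine Finset.measurable_sum _ fun i _ => Finset.measurable_sum _ fun j _ => ?_
    exact ((hA.measurable i j).sub_const _).const_mul _
  · rw [Real.norm_eq_abs, Real.abs_exp, Real.exp_le_exp]
    refine Finset.sum_le_sum fun i _ => Finset.sum_le_sum fun j _ => ?_
    refine (le_abs_self _).trans ?_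
    rw [abs_mul]
    have := hA.prob_nonneg i j
    have := hA.entry_nonneg ω i j
    have := hA.entry_le_one ω i j
    gcongr
    rw [abs_le]
    constructor <;> linarith

/-- The Chernoff bound for linear statistics of the adjacency matrix. -/
lemma chernoff (hA : IsInhomogeneousER μ p A) (c : Fin n → Fin n → ℝ) (t : ℝ) :
    μ.real {ω | t ≤ ∑ i, ∑ j, c i j * (A ω i j - p i j)} ≤
      Real.exp (∑ i, ∑ j, p i j * ((Real.exp (2 * c i j) - 1 - 2 * c i j) / 2) - t) := by
  have h := mul_meas_ge_le_integral_of_nonneg (μ := μ)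
    (.of_forall fun ω => (Real.exp_pos (∑ i, ∑ j, c i j * (A ω i j - p i j))).le)
    (hA.integrable_exp c) (Real.exp t)
  simp only [Real.exp_le_exp] at h
  have h' := h.trans (hA.integral_exp_le c)
  rw [Real.exp_sub, le_div_iff₀ (Real.exp_pos _), mul_comm]
  exact h'

end IsInhomogeneousER

/-! ### Light pairs and the union bound over lattice points. -/

/-- The centered bilinear form restricted to the pairs with a small product is bounded on integer
vectors. -/
def LightBound {n : ℕ} (h : ℕ) (R : ℝ) (B : Matrix (Fin n) (Fin n) ℝ) : Prop :=
  ∀ a b : Fin n → ℤ, ∑ i, (a i : ℝ) ^ 2 ≤ 36 * n → ∑ i, (b i : ℝ) ^ 2 ≤ 36 * n →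
    ∑ i, ∑ j, (if (a i).natAbs * (b j).natAbs ≤ 4 * 2 ^ h then (a i : ℝ) * b j else 0) * B i j ≤
      R * 2 ^ h * n

/-- The integer points of the ball of radius `6 √n`. -/
def latticeBall (n : ℕ) : Finset (Fin n → ℤ) :=
  (Fintype.piFinset fun _ => Finset.Icc (-(36 * n : ℤ)) (36 * n)).filter
    fun a => ∑ i, (a i) ^ 2 ≤ 36 * n

lemma mem_latticeBall {n : ℕ} {a : Fin n → ℤ} :
    a ∈ latticeBall n ↔ ∑ i, (a i : ℝ) ^ 2 ≤ 36 * n := by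
  have hcast : (∑ i, (a i : ℝ) ^ 2 ≤ 36 * n) ↔ ∑ i, (a i) ^ 2 ≤ 36 * (n : ℤ) := by
    exact_mod_cast Iff.rfl
  rw [hcast]
  simp only [latticeBall, Finset.mem_filter, Fintype.mem_piFinset, Finset.mem_Icc,
    and_iff_right_iff_imp]
  intro h i
  have h1 : a i ^ 2 ≤ 36 * (n : ℤ) :=
    (Finset.single_le_sum (f := fun i => (a i) ^ 2) (fun _ _ => by positivity)
      (Finset.mem_univ i)).trans h
  constructor <;> nlinarith

lemma sum_Icc_half_pow_natAbs_le (m : ℕ) :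
    ∑ k ∈ Finset.Icc (-(m : ℤ)) m, (1 / 2 : ℝ) ^ k.natAbs ≤ 3 := by
  have h : ∑ k ∈ Finset.Icc (-(m : ℤ)) m, (1 / 2 : ℝ) ^ k.natAbs = 3 - 2 * (1 / 2) ^ m := by
    induction m with
    | zero => norm_num
    | succ m ih =>
      have hI : Finset.Icc (-((m + 1 : ℕ) : ℤ)) ((m + 1 : ℕ) : ℤ) =
          insert (-((m + 1 : ℕ) : ℤ)) (insert ((m + 1 : ℕ) : ℤ) (Finset.Icc (-(m : ℤ)) m)) := by
        ext k; simp only [Finset.mem_insert, Finset.mem_Icc]; push_cast; omega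
      rw [hI, Finset.sum_insert (by simp only [Finset.mem_insert, Finset.mem_Icc]; push_cast; omega),
        Finset.sum_insert (by simp only [Finset.mem_Icc]; push_cast; omega), ih, Int.natAbs_neg,
        Int.natAbs_natCast, pow_succ]
      ring
  rw [h]
  linarith [show (0 : ℝ) ≤ 2 * (1 / 2) ^ m by positivity]

/-- For integers `|k| ≤ k ^ 2`, so ball points have `ℓ¹` norm at most `36 n`. Weighting each point
by `2 ^ (-‖a‖₁)` makes the count a product of one-dimensional sums, each at most 3. -/
lemma card_latticeBall_le (n : ℕ) : ((latticeBall n).card : ℝ) ≤ Real.exp (38 * n) := by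
  have h2e : (2 : ℝ) ≤ Real.exp 1 := by
    have := Real.exp_one_gt_d9; linarith
  have h1 : ∀ a ∈ latticeBall n, (1 : ℝ) ≤ Real.exp (36 * n) * ∏ i, (1 / 2 : ℝ) ^ (a i).natAbs := by
    intro a ha
    rw [mem_latticeBall] at ha
    have hs : ∑ i, (a i).natAbs ≤ 36 * n := by
      have : (∑ i, (a i).natAbs : ℝ) ≤ 36 * n := by
        refine le_trans (Finset.sum_le_sum fun i _ => ?_) ha
        have h3 : (a i).natAbs ≤ (a i).natAbs ^ 2 := Nat.le_self_pow (by norm_num) _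
        calc ((a i).natAbs : ℝ) ≤ ((a i).natAbs : ℝ) ^ 2 := by exact_mod_cast h3
          _ = (a i : ℝ) ^ 2 := by rw [Nat.cast_natAbs]; push_cast; rw [sq_abs]
      exact_mod_cast this
    rw [Finset.prod_pow_eq_pow_sum, one_div, inv_pow, ← div_eq_mul_inv, one_le_div (by positivity)]
    calc (2 : ℝ) ^ ∑ i, (a i).natAbs ≤ 2 ^ (36 * n) := by gcongr; norm_num
      _ ≤ Real.exp 1 ^ (36 * n) := by gcongr
      _ = Real.exp (36 * n) := by rw [← Real.exp_nat_mul]; push_cast; ring_nf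
  have h3 : (3 : ℝ) ^ n ≤ Real.exp (2 * n) := by
    have : (3 : ℝ) ≤ Real.exp 2 := by
      have : Real.exp 2 = Real.exp 1 ^ 2 := by rw [← Real.exp_nat_mul]; norm_num
      nlinarith
    calc (3 : ℝ) ^ n ≤ Real.exp 2 ^ n := by gcongr
      _ = _ := by rw [← Real.exp_nat_mul, mul_comm]
  calc ((latticeBall n).card : ℝ) = ∑ a ∈ latticeBall n, (1 : ℝ) := by simp
    _ ≤ ∑ a ∈ latticeBall n, Real.exp (36 * n) * ∏ i, (1 / 2 : ℝ) ^ (a i).natAbs :=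
        Finset.sum_le_sum h1
    _ ≤ ∑ a ∈ Fintype.piFinset fun _ : Fin n => Finset.Icc (-(36 * n : ℤ)) (36 * n),
          Real.exp (36 * n) * ∏ i, (1 / 2 : ℝ) ^ (a i).natAbs :=
        Finset.sum_le_sum_of_subset_of_nonneg (Finset.filter_subset _ _)
          fun _ _ _ => by positivity
    _ = Real.exp (36 * n) *
          ∏ _i : Fin n, ∑ k ∈ Finset.Icc (-(36 * n : ℤ)) (36 * n), (1 / 2 : ℝ) ^ k.natAbs := by
        rw [← Finset.mul_sum, Finset.prod_univ_sum]
    _ ≤ Real.exp (36 * n) * 3 ^ n := by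
        gcongr
        rw [Finset.prod_const, Finset.card_univ, Fintype.card_fin]
        have := sum_Icc_half_pow_natAbs_le (36 * n)
        push_cast at this
        gcongr
    _ ≤ Real.exp (36 * n) * Real.exp (2 * n) := by gcongr
    _ = _ := by rw [← Real.exp_add]; ring_nf

lemma exp_sub_one_sub_le_sq {x : ℝ} (hx : |x| ≤ 1) : Real.exp x - 1 - x ≤ x ^ 2 := by
  have := Real.abs_exp_sub_one_sub_id_le hx
  exact (le_abs_self _).trans this

namespace IsInhomogeneousER

variable {Ω : Type*} [MeasurableSpace Ω] {μ : Measure Ω} [IsProbabilityMeasure μ] {n : ℕ}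
  {p : Matrix (Fin n) (Fin n) ℝ} {A : Ω → Matrix (Fin n) (Fin n) ℝ}

lemma measure_light_le (hA : IsInhomogeneousER μ p A) (hn : 1 ≤ n) {h : ℕ}
    (hp : ∀ i j, p i j ≤ 4 ^ h / n) (R : ℝ) {a b : Fin n → ℤ}
    (ha : ∑ i, (a i : ℝ) ^ 2 ≤ 36 * n) (hb : ∑ i, (b i : ℝ) ^ 2 ≤ 36 * n) :
    μ.real {ω | R * 2 ^ h * n ≤ ∑ i, ∑ j,
      (if (a i).natAbs * (b j).natAbs ≤ 4 * 2 ^ h then (a i : ℝ) * b j else 0) *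
        (A ω - p) i j} ≤ Real.exp ((41 - R / 8) * n) := by
  have hn0 : (0 : ℝ) < n := by exact_mod_cast hn
  set f : Fin n → Fin n → ℝ := fun i j =>
    if (a i).natAbs * (b j).natAbs ≤ 4 * 2 ^ h then (a i : ℝ) * b j else 0 with hf
  -- This makes `|2 θ f| ≤ 1` for light coefficients, so the exponential is quadratic; the variance
  -- term is then `2 * 36 ^ 2 / 64 * n ≤ 41 n`.
  set θ : ℝ := (8 * 2 ^ h)⁻¹ with hθ
  have hθ0 : 0 < θ := by positivity
  have hθ2 : θ * 2 ^ h = 1 / 8 := by rw [hθ]; field_simp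
  have h42 : (4 : ℝ) ^ h = 2 ^ h * 2 ^ h := by rw [← mul_pow]; norm_num
  have hfabs : ∀ i j, |f i j| ≤ 4 * 2 ^ h := by
    intro i j
    simp only [hf]
    split_ifs with hc
    · have : (((a i).natAbs * (b j).natAbs : ℕ) : ℝ) ≤ ((4 * 2 ^ h : ℕ) : ℝ) := by
        exact_mod_cast hc
      push_cast at this
      rw [abs_mul]
      simpa [Nat.cast_natAbs] using this
    · simp
  have hfsq : ∀ i j, f i j ^ 2 ≤ (a i : ℝ) ^ 2 * (b j : ℝ) ^ 2 := by
    intro i j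
    simp only [hf]
    split_ifs
    · rw [mul_pow]
    · rw [zero_pow two_ne_zero]; positivity
  have hc := hA.chernoff (fun i j => θ * f i j) (θ * (R * 2 ^ h * n))
  have hset : {ω | R * 2 ^ h * n ≤ ∑ i, ∑ j, f i j * (A ω - p) i j} =
      {ω | θ * (R * 2 ^ h * n) ≤ ∑ i, ∑ j, θ * f i j * (A ω i j - p i j)} := by
    ext ω
    simp only [Set.mem_ofPred_eq, mul_assoc θ (f _ _), ← Finset.mul_sum, Matrix.sub_apply]
    rw [mul_le_mul_iff_right₀ hθ0]
  rw [hset]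
  refine hc.trans (Real.exp_le_exp.2 ?_)
  have hterm : ∀ i j, p i j * ((Real.exp (2 * (θ * f i j)) - 1 - 2 * (θ * f i j)) / 2) ≤
      4 ^ h / n * (2 * θ ^ 2) * ((a i : ℝ) ^ 2 * (b j : ℝ) ^ 2) := by
    intro i j
    have h1 : |2 * (θ * f i j)| ≤ 1 := by
      rw [abs_mul, abs_mul, abs_of_pos hθ0, abs_two]
      have := mul_le_mul_of_nonneg_left (hfabs i j) hθ0.le
      nlinarith
    have h2 := exp_sub_one_sub_le_sq h1
    have hpn := hA.prob_nonneg i j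
    calc _ ≤ p i j * ((2 * (θ * f i j)) ^ 2 / 2) := by gcongr
      _ = p i j * (2 * θ ^ 2) * f i j ^ 2 := by ring
      _ ≤ _ := by
        have := hp i j
        have := hfsq i j
        gcongr
  have hsum : ∑ i, ∑ j, p i j * ((Real.exp (2 * (θ * f i j)) - 1 - 2 * (θ * f i j)) / 2) ≤
      41 * n := by
    calc _ ≤ ∑ i, ∑ j, 4 ^ h / n * (2 * θ ^ 2) * ((a i : ℝ) ^ 2 * (b j : ℝ) ^ 2) :=
          Finset.sum_le_sum fun i _ => Finset.sum_le_sum fun j _ => hterm i j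
      _ = 4 ^ h / n * (2 * θ ^ 2) * ((∑ i, (a i : ℝ) ^ 2) * ∑ j, (b j : ℝ) ^ 2) := by
          simp only [← Finset.mul_sum]; rw [← Finset.sum_mul]
      _ ≤ 4 ^ h / n * (2 * θ ^ 2) * ((36 * n) * (36 * n)) := by gcongr
      _ = (θ * 2 ^ h) ^ 2 * (2592 * n) := by rw [h42]; field_simp; ring
      _ ≤ 41 * n := by rw [hθ2]; nlinarith
  have : θ * (R * 2 ^ h * n) = R / 8 * n := by
    calc θ * (R * 2 ^ h * n) = θ * 2 ^ h * (R * n) := by ring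
      _ = _ := by rw [hθ2]; ring
  rw [this]
  linarith

lemma measure_not_lightBound_le (hA : IsInhomogeneousER μ p A) (hn : 1 ≤ n) {h : ℕ}
    (hp : ∀ i j, p i j ≤ 4 ^ h / n) {r : ℝ} (hr : 1 ≤ r) :
    μ.real {ω | ¬ LightBound h (8 * (118 + r)) (A ω - p)} ≤ Real.exp (-r) / 2 := by
  have hn0 : (1 : ℝ) ≤ n := by exact_mod_cast hn
  -- The union bound costs `2 * 38 = 76` and the variance 41, both per unit of `n`; `R / 8 = 118 +
  -- r` leaves the exponent `-(r + 1) n`.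
  set R := 8 * (118 + r) with hR
  have hsub : {ω | ¬ LightBound h R (A ω - p)} ⊆ ⋃ x ∈ latticeBall n ×ˢ latticeBall n,
      {ω | R * 2 ^ h * n ≤ ∑ i, ∑ j,
        (if (x.1 i).natAbs * (x.2 j).natAbs ≤ 4 * 2 ^ h then (x.1 i : ℝ) * x.2 j else 0) *
          (A ω - p) i j} := by
    intro ω hω
    simp only [LightBound, Set.mem_ofPred_eq, not_forall, not_le] at hω
    obtain ⟨a, b, ha, hb, hlt⟩ := hω
    simp only [Set.mem_iUnion]
    exact ⟨(a, b), Finset.mem_product.2 ⟨mem_latticeBall.2 ha, mem_latticeBall.2 hb⟩, hlt.le⟩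
  refine (measureReal_mono hsub (measure_ne_top _ _)).trans ((measureReal_biUnion_finset_le _ _).trans ?_)
  have hle : ∀ x ∈ latticeBall n ×ˢ latticeBall n, μ.real {ω | R * 2 ^ h * n ≤ ∑ i, ∑ j,
        (if (x.1 i).natAbs * (x.2 j).natAbs ≤ 4 * 2 ^ h then (x.1 i : ℝ) * x.2 j else 0) *
          (A ω - p) i j} ≤ Real.exp ((41 - R / 8) * n) := by
    intro x hx
    rw [Finset.mem_product] at hx
    exact hA.measure_light_le hn hp R (mem_latticeBall.1 hx.1) (mem_latticeBall.1 hx.2)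
  refine (Finset.sum_le_sum hle).trans ?_
  rw [Finset.sum_const, Finset.card_product, nsmul_eq_mul]
  push_cast
  have hcard := card_latticeBall_le n
  calc ((latticeBall n).card : ℝ) * (latticeBall n).card * Real.exp ((41 - R / 8) * n)
      ≤ Real.exp (38 * n) * Real.exp (38 * n) * Real.exp ((41 - R / 8) * n) := by gcongr
    _ = Real.exp ((-(r + 1)) * n) := by
        rw [← Real.exp_add, ← Real.exp_add, hR]; congr 1; ring
    _ ≤ Real.exp (-r + -1) := by
        rw [Real.exp_le_exp]; nlinarith
    _ ≤ Real.exp (-r) / 2 := by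
        rw [Real.exp_add, div_eq_mul_inv]
        have : Real.exp (-1) ≤ 2⁻¹ := by
          rw [Real.exp_neg]
          have := Real.exp_one_gt_d9
          gcongr; linarith
        gcongr

/-! ### Edge counts and the union bound over pairs of vertex sets. -/

lemma measure_edges_le (hA : IsInhomogeneousER μ p A) {h : ℕ}
    (hp : ∀ i j, p i j ≤ 4 ^ h / n) (S T : Finset (Fin n)) (L E : ℝ) :
    μ.real {ω | S.card * T.card * (4 ^ h / n) * Real.exp (2 * L) + E ≤
      L * ∑ i ∈ S, ∑ j ∈ T, A ω i j} ≤ Real.exp (-E) := by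
  set m : ℝ := S.card * T.card * (4 ^ h / n) with hm
  set m₀ : ℝ := ∑ i ∈ S, ∑ j ∈ T, p i j with hm₀
  have hm₀0 : 0 ≤ m₀ :=
    Finset.sum_nonneg fun i _ => Finset.sum_nonneg fun j _ => hA.prob_nonneg i j
  have hmm : m₀ ≤ m := by
    calc m₀ ≤ ∑ i ∈ S, ∑ j ∈ T, (4 : ℝ) ^ h / n :=
          Finset.sum_le_sum fun i _ => Finset.sum_le_sum fun j _ => hp i j
      _ = m := by simp only [Finset.sum_const, nsmul_eq_mul, hm]; ring
  have hind : ∀ f : Fin n → Fin n → ℝ,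
      ∑ i, ∑ j, (if i ∈ S ∧ j ∈ T then f i j else 0) = ∑ i ∈ S, ∑ j ∈ T, f i j := by
    intro f
    simp only [ite_and]
    rw [← Finset.sum_filter_add_sum_filter_not Finset.univ (· ∈ S)]
    simp [Finset.sum_ite_mem, Finset.filter_not]
  -- After the centering term `L * m₀` cancels, the exponent is `m₀ (exp (2 L) - 1) / 2 - m exp (2
  -- L) - E`, at most `-E` because `0 ≤ m₀ ≤ m`.
  have hc := hA.chernoff (fun i j => if i ∈ S ∧ j ∈ T then L else 0)
    (m * Real.exp (2 * L) + E - L * m₀)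
  have e1 : ∀ ω, ∑ i, ∑ j, (if i ∈ S ∧ j ∈ T then L else 0) * (A ω i j - p i j) =
      L * ∑ i ∈ S, ∑ j ∈ T, A ω i j - L * m₀ := by
    intro ω
    simp only [ite_mul, zero_mul]
    rw [hind fun i j => L * (A ω i j - p i j)]
    simp only [hm₀, ← Finset.mul_sum, Finset.sum_sub_distrib, mul_sub]
  have e2 : ∑ i, ∑ j, p i j * ((Real.exp (2 * (if i ∈ S ∧ j ∈ T then L else 0)) - 1 -
      2 * (if i ∈ S ∧ j ∈ T then L else 0)) / 2) = m₀ * ((Real.exp (2 * L) - 1 - 2 * L) / 2) := by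
    rw [hm₀, Finset.sum_mul]
    simp only [Finset.sum_mul]
    rw [← hind fun i j => p i j * ((Real.exp (2 * L) - 1 - 2 * L) / 2)]
    refine Finset.sum_congr rfl fun i _ => Finset.sum_congr rfl fun j _ => ?_
    split_ifs <;> simp
  simp only [e1, e2, sub_le_sub_iff_right] at hc
  refine hc.trans (Real.exp_le_exp.2 ?_)
  have := Real.exp_pos (2 * L)
  nlinarith [mul_le_mul_of_nonneg_right hmm this.le]

end IsInhomogeneousER

lemma one_add_log_le_ent {n s : ℕ} (hs : 1 ≤ s) (hsn : s ≤ n) : 1 + Real.log n ≤ ent n s := by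
  have hs' : (1 : ℝ) ≤ s := by exact_mod_cast hs
  have hsn' : (s : ℝ) ≤ n := by exact_mod_cast hsn
  have h1 := Real.log_le_sub_one_of_pos (show (0 : ℝ) < s by linarith)
  have h2 : 0 ≤ Real.log (n / s) := Real.log_nonneg ((one_le_div (by linarith)).2 hsn')
  have h3 : Real.log n = Real.log (n / s) + Real.log s := by
    have hn0 : (0 : ℝ) < n := by linarith
    rw [← Real.log_mul (by positivity) (by positivity), div_mul_cancel₀ _ (by positivity)]
  unfold ent
  nlinarith

/-- One term of the binomial expansion of `(1 + s / n) ^ n ≤ exp s` bounds `choose n s * (s / n) ^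
s`. -/
lemma choose_mul_exp_neg_ent_le {n s : ℕ} (hsn : s ≤ n) :
    (n.choose s : ℝ) * Real.exp (-ent n s) ≤ 1 := by
  rcases Nat.eq_zero_or_pos s with rfl | hs
  · simp [ent]
  have hs' : (0 : ℝ) < s := by exact_mod_cast hs
  have hn' : (0 : ℝ) < n := by exact_mod_cast lt_of_lt_of_le hs hsn
  have h1 : Real.exp (-ent n s) = ((s : ℝ) / n) ^ s * Real.exp (-s) := by
    have : Real.log (n / s) = -Real.log (s / n) := by rw [← Real.log_inv, inv_div]
    rw [ent, this, ← Real.exp_log (show 0 < ((s : ℝ) / n) ^ s by positivity), Real.log_pow,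
      ← Real.exp_add]
    congr 1; ring
  have h2 : (n.choose s : ℝ) * ((s : ℝ) / n) ^ s ≤ (s / n + 1) ^ n := by
    rw [add_pow]
    refine le_trans ?_ (Finset.single_le_sum (fun i _ => by positivity)
      (Finset.mem_range.2 (Nat.lt_succ_of_le hsn)))
    simp [mul_comm]
  have h3 : ((s : ℝ) / n + 1) ^ n ≤ Real.exp s := by
    calc ((s : ℝ) / n + 1) ^ n ≤ Real.exp (s / n) ^ n := by
          gcongr; exact Real.add_one_le_exp _
      _ = Real.exp s := by rw [← Real.exp_nat_mul, mul_div_cancel₀ _ hn'.ne']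
  rw [h1, ← mul_assoc, Real.exp_neg, ← div_eq_mul_inv, div_le_one (Real.exp_pos _)]
  exact h2.trans h3

lemma sum_exp_neg_ent_le (n : ℕ) :
    ∑ S : Finset (Fin n), Real.exp (-ent n S.card) ≤ n + 1 := by
  rw [← Finset.powerset_univ, Finset.sum_powerset_apply_card (fun s => Real.exp (-ent n s))]
  simp only [Finset.card_univ, Fintype.card_fin, nsmul_eq_mul]
  calc _ ≤ ∑ _s ∈ Finset.range (n + 1), (1 : ℝ) := Finset.sum_le_sum fun s hs =>
        choose_mul_exp_neg_ent_le (Nat.lt_succ_iff.1 (Finset.mem_range.1 hs))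
    _ = n + 1 := by simp

/-- One copy of the entropy pays for counting the sets. The other `r + 3` copies, each at least `1 +
log n` on nonempty sets, give `exp (-r)`, a small constant and `n ^ (-3)`, one power of which is
lost to the number of cardinalities. -/
lemma sum_nonempty_exp_neg_ent_le {n : ℕ} (hn : 1 ≤ n) {r : ℝ} (hr : 1 ≤ r) :
    ∑ S : Finset (Fin n) with S.Nonempty, Real.exp (-((r + 4) * ent n S.card)) ≤
      Real.exp (-r) / 4 * (n ^ 2 : ℝ)⁻¹ := by
  have hn0 : (1 : ℝ) ≤ n := by exact_mod_cast hn
  have hlog : 0 ≤ Real.log n := Real.log_nonneg hn0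
  have hterm : ∀ S ∈ Finset.univ.filter (fun S : Finset (Fin n) => S.Nonempty),
      Real.exp (-((r + 4) * ent n S.card)) ≤
        (Real.exp (-r) / 8 * (n ^ 3 : ℝ)⁻¹) * Real.exp (-ent n S.card) := by
    intro S hS
    have hS' : 1 ≤ S.card := Finset.card_pos.2 (Finset.mem_filter.1 hS).2
    have h1 := one_add_log_le_ent hS' (by simpa using S.card_le_univ)
    have h8 : Real.exp (-3) ≤ 1 / 8 := by
      rw [Real.exp_neg, one_div]
      have : Real.exp 3 = Real.exp 1 ^ 3 := by rw [← Real.exp_nat_mul]; norm_num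
      have h2 : (2 : ℝ) ≤ Real.exp 1 := by have := Real.exp_one_gt_d9; linarith
      have : (2 : ℝ) ^ 3 ≤ Real.exp 1 ^ 3 := by gcongr
      gcongr; linarith
    have hn3 : Real.exp (-(3 * Real.log n)) = (n ^ 3 : ℝ)⁻¹ := by
      rw [Real.exp_neg, show (3 : ℝ) * Real.log n = ((3 : ℕ) : ℝ) * Real.log n by norm_num,
        ← Real.log_pow, Real.exp_log (by positivity)]
    calc Real.exp (-((r + 4) * ent n S.card))
        ≤ Real.exp (-r + -3 + -(3 * Real.log n) + -ent n S.card) := by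
          rw [Real.exp_le_exp]; nlinarith
      _ = Real.exp (-r) * Real.exp (-3) * (n ^ 3 : ℝ)⁻¹ * Real.exp (-ent n S.card) := by
          rw [Real.exp_add, Real.exp_add, Real.exp_add, hn3]
      _ ≤ Real.exp (-r) * (1 / 8) * (n ^ 3 : ℝ)⁻¹ * Real.exp (-ent n S.card) := by gcongr
      _ = _ := by ring
  refine (Finset.sum_le_sum hterm).trans ?_
  rw [← Finset.mul_sum]
  calc _ ≤ (Real.exp (-r) / 8 * (n ^ 3 : ℝ)⁻¹) * (n + 1) := by
        gcongr
        refine le_trans (Finset.sum_le_sum_of_subset_of_nonneg (Finset.filter_subset _ _)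
          fun _ _ _ => (Real.exp_pos _).le) (sum_exp_neg_ent_le n)
    _ ≤ (Real.exp (-r) / 8 * (n ^ 3 : ℝ)⁻¹) * (2 * n) := by gcongr; linarith
    _ = _ := by field_simp; ring

namespace IsInhomogeneousER

variable {Ω : Type*} [MeasurableSpace Ω] {μ : Measure Ω} [IsProbabilityMeasure μ] {n : ℕ}
  {p : Matrix (Fin n) (Fin n) ℝ} {A : Ω → Matrix (Fin n) (Fin n) ℝ}

lemma measure_not_discrepancy_le (hA : IsInhomogeneousER μ p A) (hn : 1 ≤ n) {h : ℕ}
    (hp : ∀ i j, p i j ≤ 4 ^ h / n) {r : ℝ} (hr : 1 ≤ r) :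
    μ.real {ω | ¬ Discrepancy h (r + 4) (A ω)} ≤ Real.exp (-r) / 2 := by
  have hn0 : (1 : ℝ) ≤ n := by exact_mod_cast hn
  have hcard : ∀ S : Finset (Fin n), S.card ≤ n := fun S => by simpa using S.card_le_univ
  set F : Finset (Finset (Fin n)) := Finset.univ.filter fun S => S.Nonempty with hF
  have hsub : {ω | ¬ Discrepancy h (r + 4) (A ω)} ⊆ ⋃ x ∈ (F ×ˢ F) ×ˢ Finset.range (n + 6),
      {ω | x.1.1.card * x.1.2.card * (4 ^ h / n) * Real.exp (2 * (1 + (x.2 : ℝ) / 4)) +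
        (r + 4) * (ent n x.1.1.card + ent n x.1.2.card) ≤
          (1 + (x.2 : ℝ) / 4) * ∑ i ∈ x.1.1, ∑ j ∈ x.1.2, A ω i j} := by
    intro ω hω
    simp only [Discrepancy, Set.mem_ofPred_eq, not_forall, not_le] at hω
    obtain ⟨S, T, q, hq, hlt⟩ := hω
    -- A violated inequality forces a positive edge count, so both sets are nonempty and the
    -- nonempty-set bound applies.
    have hpos : 0 < (1 + (q : ℝ) / 4) * ∑ i ∈ S, ∑ j ∈ T, A ω i j := by
      refine lt_of_le_of_lt ?_ hlt
      have := ent_nonneg (hcard S)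
      have := ent_nonneg (hcard T)
      positivity
    have hS : S.Nonempty := by
      rw [Finset.nonempty_iff_ne_empty]; rintro rfl; simp at hpos
    have hT : T.Nonempty := by
      rw [Finset.nonempty_iff_ne_empty]; rintro rfl; simp at hpos
    simp only [Set.mem_iUnion]
    refine ⟨((S, T), q), ?_, hlt.le⟩
    simp [hF, hS, hT, hq]
  refine (measureReal_mono hsub (measure_ne_top _ _)).trans ((measureReal_biUnion_finset_le _ _).trans ?_)
  refine (Finset.sum_le_sum fun x _ => hA.measure_edges_le hp x.1.1 x.1.2 _ _).trans ?_
  set G : ℝ := ∑ S ∈ F, Real.exp (-((r + 4) * ent n S.card)) with hG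
  have hG1 : G ≤ Real.exp (-r) / 4 * (n ^ 2 : ℝ)⁻¹ := sum_nonempty_exp_neg_ent_le hn hr
  have hG0 : 0 ≤ G := Finset.sum_nonneg fun _ _ => (Real.exp_pos _).le
  have e : ∑ x ∈ (F ×ˢ F) ×ˢ Finset.range (n + 6),
      Real.exp (-((r + 4) * (ent n x.1.1.card + ent n x.1.2.card))) = (n + 6) * (G * G) := by
    rw [Finset.sum_product_right]
    simp only [Finset.sum_const, Finset.card_range, nsmul_eq_mul]
    push_cast
    congr 1
    rw [hG, Finset.sum_mul_sum, ← Finset.sum_product']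
    refine Finset.sum_congr rfl fun x _ => ?_
    rw [← Real.exp_add]; congr 1; ring
  rw [e]
  have hr1 : Real.exp (-r) ≤ 1 := by rw [Real.exp_le_one_iff]; linarith
  have hr0 := Real.exp_pos (-r)
  have hnn : (n ^ 2 : ℝ)⁻¹ ≤ 1 := inv_le_one_of_one_le₀ (by nlinarith)
  have hb : (n + 6 : ℝ) * (n ^ 2 : ℝ)⁻¹ ≤ 7 := by
    rw [← div_eq_mul_inv, div_le_iff₀ (by positivity)]; nlinarith
  calc (n + 6 : ℝ) * (G * G) ≤
        (n + 6 : ℝ) * ((Real.exp (-r) / 4 * (n ^ 2 : ℝ)⁻¹) * (1 / 4 * 1)) := by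
        gcongr
        exact hG1.trans (by gcongr)
    _ = (n + 6 : ℝ) * (n ^ 2 : ℝ)⁻¹ * (Real.exp (-r) / 16) := by ring
    _ ≤ 7 * (Real.exp (-r) / 16) := by gcongr
    _ ≤ _ := by linarith

end IsInhomogeneousER

/-! ### The weighted bound for the centered matrix. -/

section Deterministic

variable {n : ℕ}

/-- Discrepancy for the full vertex set with `q = 0` gives `8 * 4 ^ h * n + 2 (r + 4) n`. This
normalizes the degree part of the weights to have total at most `n`. -/
lemma sum_entries_le_of_discrepancy (hn : 1 ≤ n) {h : ℕ} {r : ℝ} (hr : 1 ≤ r)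
    {A : Matrix (Fin n) (Fin n) ℝ} (hd : Discrepancy h (r + 4) A) :
    ∑ i, degree A i ≤ 18 * r * 4 ^ h * n := by
  have hn0 : (0 : ℝ) < n := by exact_mod_cast hn
  have h1 := hd Finset.univ Finset.univ 0 (by omega)
  have hent : ent n n = n := by simp [ent, hn0.ne']
  simp only [Nat.cast_zero, zero_div, add_zero, one_mul, mul_one, Finset.card_univ,
    Fintype.card_fin, hent] at h1
  have h3 : Real.exp 2 ≤ 8 := by
    have h2 : Real.exp 1 < 2.7182818286 := Real.exp_one_lt_d9
    have : Real.exp 2 = Real.exp 1 ^ 2 := by rw [← Real.exp_nat_mul]; norm_num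
    nlinarith [Real.exp_pos 1]
  have h4 : (1 : ℝ) ≤ 4 ^ h := one_le_pow₀ (by norm_num)
  have h5 : (n : ℝ) * n * (4 ^ h / n) = 4 ^ h * n := by field_simp
  rw [h5] at h1
  have h6 : (4 : ℝ) ^ h * n * Real.exp 2 ≤ 4 ^ h * n * 8 := by gcongr
  have h7 : (n : ℝ) ≤ 4 ^ h * n := le_mul_of_one_le_left hn0.le h4
  have h8 : (4 : ℝ) ^ h * n ≤ r * (4 ^ h * n) := le_mul_of_one_le_left (by positivity) hr
  have h9 : r * n ≤ r * (4 ^ h * n) := by gcongr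
  have : ∑ i, degree A i = ∑ i, ∑ j, A i j := rfl
  rw [this]
  nlinarith

/-- The bilinear form of the centered matrix on integer vectors of bounded weighted norm. -/
lemma bilin_intVec_le (hn : 1 ≤ n) {h : ℕ} {r : ℝ} (hr : 1 ≤ r)
    {A p : Matrix (Fin n) (Fin n) ℝ} (hA0 : ∀ i j, 0 ≤ A i j) (hAs : A.IsSymm)
    (hp0 : ∀ i j, 0 ≤ p i j) (hp : ∀ i j, p i j ≤ 4 ^ h / n)
    (hd : Discrepancy h (r + 4) A) (hl : LightBound h (8 * (118 + r)) (A - p))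
    {a b : Fin n → ℤ}
    (ha : ∑ i, (1 + degree A i / (18 * r * 4 ^ h)) * (a i : ℝ) ^ 2 ≤ 36 * (n : ℝ))
    (hb : ∑ i, (1 + degree A i / (18 * r * 4 ^ h)) * (b i : ℝ) ^ 2 ≤ 36 * (n : ℝ)) :
    bilin (A - p) (fun i => (a i : ℝ)) (fun i => (b i : ℝ)) ≤ 36 * n * (1800 * r * 2 ^ h) := by
  have hn0 : (0 : ℝ) < n := by exact_mod_cast hn
  have hr0 : 0 < r := by linarith
  have h42 : (4 : ℝ) ^ h = 2 ^ h * 2 ^ h := by rw [← mul_pow]; norm_num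
  set D : ℝ := 18 * r * 4 ^ h with hD
  have hD0 : 0 < D := by positivity
  have hdeg : ∀ i, 0 ≤ degree A i := fun i => Finset.sum_nonneg fun j _ => hA0 i j
  have hsq : ∀ c : Fin n → ℤ, ∑ i, (1 + degree A i / D) * (c i : ℝ) ^ 2 ≤ 36 * (n : ℝ) →
      ∑ i, (c i : ℝ) ^ 2 ≤ 36 * n ∧ ∑ i, degree A i * (c i : ℝ) ^ 2 ≤ 36 * n * D := by
    intro c hc
    have e : ∑ i, (1 + degree A i / D) * (c i : ℝ) ^ 2 =
        ∑ i, (c i : ℝ) ^ 2 + (∑ i, degree A i * (c i : ℝ) ^ 2) / D := by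
      rw [Finset.sum_div, ← Finset.sum_add_distrib]
      exact Finset.sum_congr rfl fun i _ => by ring
    have n1 : 0 ≤ ∑ i, (c i : ℝ) ^ 2 := Finset.sum_nonneg fun i _ => by positivity
    have n2 : 0 ≤ (∑ i, degree A i * (c i : ℝ) ^ 2) / D :=
      div_nonneg (Finset.sum_nonneg fun i _ => mul_nonneg (hdeg i) (by positivity)) hD0.le
    rw [e] at hc
    refine ⟨by linarith, ?_⟩
    rw [← div_le_iff₀ hD0]
    linarith
  obtain ⟨ha1, ha2⟩ := hsq a ha
  obtain ⟨hb1, hb2⟩ := hsq b hb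
  have hcast : ∀ k : ℤ, ((k.natAbs : ℕ) : ℝ) ^ 2 = (k : ℝ) ^ 2 := by
    intro k; rw [Nat.cast_natAbs]; push_cast; rw [sq_abs]
  have hheavy := hd.sum_heavy_le (α := fun i => (a i).natAbs) (β := fun i => (b i).natAbs)
    (D := 36 * n * D) hn hA0 (by linarith) (by simpa only [hcast] using ha1)
    (by simpa only [hcast] using hb1)
    (by
      simp only [hcast, ← Finset.sum_mul]
      exact ha2)
    (by
      rw [Finset.sum_comm]
      simp only [hcast, ← Finset.sum_mul]
      refine le_trans (le_of_eq (Finset.sum_congr rfl fun i _ => ?_)) hb2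
      congr 1
      exact Finset.sum_congr rfl fun j _ => hAs.apply i j)
  have hlight := hl a b ha1 hb1
  -- On heavy pairs `A` and `p` are treated separately: the mean is bounded using `|a i b j| ≤ (a i
  -- b j) ^ 2 / (4 * 2 ^ h)`.
  have hpt : ∀ i j, (A - p) i j * (a i : ℝ) * b j ≤
      (if (a i).natAbs * (b j).natAbs ≤ 4 * 2 ^ h then (a i : ℝ) * b j else 0) * (A - p) i j +
      (if 4 * 2 ^ h < (a i).natAbs * (b j).natAbs then
        A i j * (((a i).natAbs : ℝ) * ((b j).natAbs : ℝ)) else 0) +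
      4 ^ h / n / (4 * 2 ^ h) * ((a i : ℝ) ^ 2 * (b j : ℝ) ^ 2) := by
    intro i j
    have hAij := hA0 i j
    have hpij := hp0 i j
    have hpij' := hp i j
    by_cases hc : (a i).natAbs * (b j).natAbs ≤ 4 * 2 ^ h
    · rw [if_pos hc, if_neg (by omega)]
      have : 0 ≤ (4 : ℝ) ^ h / n / (4 * 2 ^ h) * ((a i : ℝ) ^ 2 * (b j : ℝ) ^ 2) := by positivity
      linarith
    · rw [if_neg hc, if_pos (by omega)]
      set m : ℝ := ((a i).natAbs : ℝ) * ((b j).natAbs : ℝ) with hm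
      have hm4 : 4 * 2 ^ h ≤ m := by
        have : ((4 * 2 ^ h : ℕ) : ℝ) ≤ (((a i).natAbs * (b j).natAbs : ℕ) : ℝ) := by
          exact_mod_cast (not_le.1 hc).le
        push_cast at this
        simpa [hm, Nat.cast_natAbs] using this
      have habs : |(a i : ℝ) * b j| = m := by
        rw [hm, abs_mul, Nat.cast_natAbs, Nat.cast_natAbs]; push_cast; rfl
      have hm2 : (a i : ℝ) ^ 2 * (b j : ℝ) ^ 2 = m ^ 2 := by rw [← habs, sq_abs, mul_pow]
      have h1 : (a i : ℝ) * b j ≤ m := habs ▸ le_abs_self _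
      have h2 : -m ≤ (a i : ℝ) * b j := by rw [← habs]; exact neg_abs_le _
      have h3 : p i j * m ≤ 4 ^ h / n / (4 * 2 ^ h) * m ^ 2 := by
        have hm0 : 0 ≤ m := le_trans (by positivity) hm4
        calc p i j * m ≤ 4 ^ h / n * m := by gcongr
          _ = 4 ^ h / n / (4 * 2 ^ h) * (4 * 2 ^ h * m) := by field_simp
          _ ≤ 4 ^ h / n / (4 * 2 ^ h) * (m * m) := by gcongr
          _ = _ := by ring
      rw [hm2, Matrix.sub_apply]
      nlinarith [mul_le_mul_of_nonneg_left h1 hAij, mul_le_mul_of_nonneg_left h2 hpij]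
  have hmean : ∑ i, ∑ j, (4 : ℝ) ^ h / n / (4 * 2 ^ h) * ((a i : ℝ) ^ 2 * (b j : ℝ) ^ 2) ≤
      324 * 2 ^ h * (n : ℝ) := by
    calc _ = 4 ^ h / n / (4 * 2 ^ h) * ((∑ i, (a i : ℝ) ^ 2) * ∑ j, (b j : ℝ) ^ 2) := by
          simp only [← Finset.mul_sum]; rw [← Finset.sum_mul]
      _ ≤ 4 ^ h / n / (4 * 2 ^ h) * ((36 * n) * (36 * n)) := by gcongr
      _ = _ := by rw [h42]; field_simp; ring
  have htotal := Finset.sum_le_sum fun i (_ : i ∈ Finset.univ) =>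
    Finset.sum_le_sum fun j (_ : j ∈ Finset.univ) => hpt i j
  simp only [Finset.sum_add_distrib] at htotal
  have hDh : 4 * (36 * n * D) / 2 ^ h = 2592 * r * (2 ^ h * n) := by
    rw [hD, h42]; field_simp; ring
  rw [hDh] at hheavy
  have hX : 0 < (2 : ℝ) ^ h * n := by positivity
  have hX1 : (2 : ℝ) ^ h * n ≤ r * (2 ^ h * n) := le_mul_of_one_le_left hX.le hr
  unfold bilin
  nlinarith

lemma sum_weights_le (hn : 1 ≤ n) {h : ℕ} {r : ℝ} (hr : 1 ≤ r)
    {A : Matrix (Fin n) (Fin n) ℝ} (hd : Discrepancy h (r + 4) A) :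
    ∑ i, (1 + degree A i / (18 * r * 4 ^ h)) ≤ 2 * n := by
  rw [Finset.sum_add_distrib, ← Finset.sum_div]
  have h1 := sum_entries_le_of_discrepancy hn hr hd
  have : (∑ i, degree A i) / (18 * r * 4 ^ h) ≤ n := by
    rw [div_le_iff₀ (by positivity)]; linarith
  simp only [Finset.sum_const, Finset.card_univ, Fintype.card_fin, nsmul_eq_mul, mul_one]
  linarith

/-- The weighted spectral bound for the centered matrix. -/
lemma bilin_centered_le (hn : 1 ≤ n) {h : ℕ} {r : ℝ} (hr : 1 ≤ r)
    {A p : Matrix (Fin n) (Fin n) ℝ} (hA0 : ∀ i j, 0 ≤ A i j) (hAs : A.IsSymm)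
    (hp0 : ∀ i j, 0 ≤ p i j) (hp : ∀ i j, p i j ≤ 4 ^ h / n)
    (hd : Discrepancy h (r + 4) A) (hl : LightBound h (8 * (118 + r)) (A - p))
    (w z : Fin n → ℝ) :
    bilin (A - p) w z ≤ 2 * (1800 * r * 2 ^ h) *
      √(∑ i, (1 + degree A i / (18 * r * 4 ^ h)) * w i ^ 2) *
      √(∑ i, (1 + degree A i / (18 * r * 4 ^ h)) * z i ^ 2) := by
  have hdeg : ∀ i, 0 ≤ degree A i := fun i => Finset.sum_nonneg fun j _ => hA0 i j
  refine bilin_le_of_lattice hn (fun i => ?_) (sum_weights_le hn hr hd) (by positivity)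
    (fun a b ha hb => bilin_intVec_le hn hr hA0 hAs hp0 hp hd hl ha hb) w z
  have := hdeg i
  have : 0 ≤ degree A i / (18 * r * 4 ^ h) := by positivity
  linarith

/-! ### Normalized Laplacians of the regularized matrices. -/

lemma laplacian_apply (M : Matrix (Fin n) (Fin n) ℝ) (i j : Fin n) :
    laplacian M i j = degree M i ^ (-(1 / 2) : ℝ) * M i j * degree M j ^ (-(1 / 2) : ℝ) := by
  simp [laplacian, Matrix.diagonal_mul, Matrix.mul_diagonal]

lemma regularize_apply (τ : ℝ) (M : Matrix (Fin n) (Fin n) ℝ) (i j : Fin n) :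
    regularize τ M i j = M i j + τ / n := by
  simp [regularize]

lemma degree_regularize (hn : 1 ≤ n) (τ : ℝ) (M : Matrix (Fin n) (Fin n) ℝ) (i : Fin n) :
    degree (regularize τ M) i = degree M i + τ := by
  have hn0 : (n : ℝ) ≠ 0 := by positivity
  simp only [degree, regularize_apply, Finset.sum_add_distrib, Finset.sum_const, Finset.card_univ,
    Fintype.card_fin, nsmul_eq_mul]
  field_simp

lemma rpow_neg_half_sq {x : ℝ} (hx : 0 < x) : (x ^ (-(1 / 2) : ℝ)) ^ 2 = x⁻¹ := by
  rw [← Real.rpow_natCast, ← Real.rpow_mul hx.le]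
  norm_num [Real.rpow_neg_one]

/-- A Schur test: AM-GM weighted by `M i j` leaves row sums, which the normalization turns into 1.
-/
lemma bilin_laplacian_le_one {M : Matrix (Fin n) (Fin n) ℝ} (hM : ∀ i j, 0 ≤ M i j)
    (hs : M.IsSymm) (hdeg : ∀ i, 0 < degree M i) {x y : Fin n → ℝ}
    (hx : ∑ i, x i ^ 2 ≤ 1) (hy : ∑ i, y i ^ 2 ≤ 1) : bilin (laplacian M) x y ≤ 1 := by
  set α : Fin n → ℝ := fun i => degree M i ^ (-(1 / 2) : ℝ) with hα
  have hα2 : ∀ i, degree M i * α i ^ 2 = 1 := fun i => by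
    rw [hα, rpow_neg_half_sq (hdeg i), mul_inv_cancel₀ (hdeg i).ne']
  have hpt : ∀ i j, laplacian M i j * x i * y j ≤
      M i j * (α i ^ 2 * x i ^ 2) / 2 + M i j * (α j ^ 2 * y j ^ 2) / 2 := by
    intro i j
    rw [laplacian_apply]
    nlinarith [mul_nonneg (hM i j) (sq_nonneg (α i * x i - α j * y j))]
  have e1 : ∑ i, ∑ j, M i j * (α i ^ 2 * x i ^ 2) / 2 = (∑ i, x i ^ 2) / 2 := by
    rw [Finset.sum_div]
    refine Finset.sum_congr rfl fun i _ => ?_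
    rw [← Finset.sum_div, ← Finset.sum_mul]
    change degree M i * (α i ^ 2 * x i ^ 2) / 2 = _
    rw [← mul_assoc, hα2, one_mul]
  have e2 : ∑ i, ∑ j, M i j * (α j ^ 2 * y j ^ 2) / 2 = (∑ i, y i ^ 2) / 2 := by
    rw [Finset.sum_div, Finset.sum_comm]
    refine Finset.sum_congr rfl fun j _ => ?_
    rw [← Finset.sum_div, ← Finset.sum_mul]
    have : ∑ i, M i j = degree M j := Finset.sum_congr rfl fun i _ => hs.apply j i
    rw [this, ← mul_assoc, hα2, one_mul]
  refine (Finset.sum_le_sum fun i _ => Finset.sum_le_sum fun j _ => hpt i j).trans ?_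
  simp only [Finset.sum_add_distrib]
  rw [e1, e2]
  linarith

lemma specNorm_laplacian_sub_le_two {M N : Matrix (Fin n) (Fin n) ℝ} (hM : ∀ i j, 0 ≤ M i j)
    (hMs : M.IsSymm) (hMd : ∀ i, 0 < degree M i) (hN : ∀ i j, 0 ≤ N i j)
    (hNs : N.IsSymm) (hNd : ∀ i, 0 < degree N i) :
    specNorm (laplacian M - laplacian N) ≤ 2 := by
  refine specNorm_le_of_bilin_le (by norm_num) fun x y hx hy => ?_
  have h1 := bilin_laplacian_le_one hM hMs hMd hx hy
  have h2 := bilin_laplacian_le_one hN hNs hNd (x := -x) (by simpa using hx) hy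
  have : bilin (laplacian M - laplacian N) x y =
      bilin (laplacian M) x y + bilin (laplacian N) (-x) y := by
    simp only [bilin, ← Finset.sum_add_distrib, Matrix.sub_apply, Pi.neg_apply]
    exact Finset.sum_congr rfl fun i _ => Finset.sum_congr rfl fun j _ => by ring
  linarith

/-- A weighted bound for `A - p` controls the difference of the regularized Laplacians. -/
lemma specNorm_laplacian_sub_le (hn : 1 ≤ n) {τ δ m : ℝ} (hτ : 0 < τ) (hm : 0 ≤ m) (hδ : 0 ≤ δ)
    {A p : Matrix (Fin n) (Fin n) ℝ} {g : Fin n → ℝ} (hA0 : ∀ i j, 0 ≤ A i j)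
    (hp0 : ∀ i j, 0 ≤ p i j) (hp : ∀ i j, p i j + τ / n ≤ δ / n) (hg : ∀ i, 1 ≤ g i)
    (hgd : ∀ i, τ * g i ≤ degree A i + τ) (hgs : ∑ i, g i ≤ 2 * n)
    (hB : ∀ w z : Fin n → ℝ, bilin (A - p) w z ≤
      m * √(∑ i, g i * w i ^ 2) * √(∑ i, g i * z i ^ 2)) :
    specNorm (laplacian (regularize τ A) - laplacian (regularize τ p)) ≤
      m / τ + 4 * δ * m / τ ^ 2 := by
  have hn0 : (0 : ℝ) < n := by exact_mod_cast hn
  have hg0 : ∀ i, 0 < g i := fun i => lt_of_lt_of_le one_pos (hg i)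
  have hdA : ∀ i, 0 ≤ degree A i := fun i => Finset.sum_nonneg fun j _ => hA0 i j
  have hdp : ∀ i, 0 ≤ degree p i := fun i => Finset.sum_nonneg fun j _ => hp0 i j
  set a : Fin n → ℝ := fun i => degree A i + τ with ha
  set b : Fin n → ℝ := fun i => degree p i + τ with hb
  have ha0 : ∀ i, 0 < a i := fun i => add_pos_of_nonneg_of_pos (hdA i) hτ
  have hb0 : ∀ i, 0 < b i := fun i => add_pos_of_nonneg_of_pos (hdp i) hτ
  set α : Fin n → ℝ := fun i => a i ^ (-(1 / 2) : ℝ) with hα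
  set β : Fin n → ℝ := fun i => b i ^ (-(1 / 2) : ℝ) with hβ
  have hα0 : ∀ i, 0 < α i := fun i => Real.rpow_pos_of_pos (ha0 i) _
  have hβ0 : ∀ i, 0 < β i := fun i => Real.rpow_pos_of_pos (hb0 i) _
  have hα2 : ∀ i, α i ^ 2 = (a i)⁻¹ := fun i => rpow_neg_half_sq (ha0 i)
  have hβ2 : ∀ i, β i ^ 2 = (b i)⁻¹ := fun i => rpow_neg_half_sq (hb0 i)
  have hατ : ∀ i, α i ^ 2 ≤ τ⁻¹ := fun i => by
    rw [hα2]; exact inv_anti₀ hτ (by simp only [ha]; linarith [hdA i])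
  have hβτ : ∀ i, β i ^ 2 ≤ τ⁻¹ := fun i => by
    rw [hβ2]; exact inv_anti₀ hτ (by simp only [hb]; linarith [hdp i])
  have hαg : ∀ i, g i * α i ^ 2 ≤ τ⁻¹ := fun i => by
    rw [hα2, ← div_eq_mul_inv, div_le_iff₀ (ha0 i), inv_mul_eq_div, le_div_iff₀ hτ, mul_comm]
    exact hgd i
  set κ : ℝ := (√τ)⁻¹ with hκ
  have hκ0 : 0 < κ := inv_pos.2 (Real.sqrt_pos.2 hτ)
  have hκ2 : κ ^ 2 = τ⁻¹ := by rw [hκ, inv_pow, Real.sq_sqrt hτ.le]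
  have hακ : ∀ i, α i ≤ κ := fun i => by
    refine (pow_le_pow_iff_left₀ (hα0 i).le hκ0.le two_ne_zero).1 ?_; rw [hκ2]; exact hατ i
  have hβκ : ∀ i, β i ≤ κ := fun i => by
    refine (pow_le_pow_iff_left₀ (hβ0 i).le hκ0.le two_ne_zero).1 ?_; rw [hκ2]; exact hβτ i
  -- degree fluctuations
  set v : Fin n → ℝ := fun i => degree A i - degree p i with hv
  set V : ℝ := ∑ i, v i ^ 2 / g i with hV
  have hV0 : 0 ≤ V := Finset.sum_nonneg fun i _ => div_nonneg (sq_nonneg _) (hg0 i).le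
  have hVle : V ≤ 2 * n * m ^ 2 := by
    -- Duality: testing against the constant vector extracts the degree fluctuations in the dual
    -- weighted norm.
    have h1 := hB (fun i => v i / g i) (fun _ => 1)
    have e1 : bilin (A - p) (fun i => v i / g i) (fun _ => 1) = V := by
      simp only [bilin, hV, mul_one, ← Finset.sum_mul]
      refine Finset.sum_congr rfl fun i _ => ?_
      have : ∑ j, (A - p) i j = v i := by
        simp only [Matrix.sub_apply, Finset.sum_sub_distrib, hv, degree]
      rw [this]; ring
    have e2 : ∑ i, g i * (v i / g i) ^ 2 = V := by
      refine Finset.sum_congr rfl fun i _ => ?_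
      have := (hg0 i).ne'
      field_simp
    rw [e1, e2] at h1
    simp only [one_pow, mul_one] at h1
    have h2 : √(∑ i, g i) ≤ √(2 * n) := Real.sqrt_le_sqrt hgs
    have h3 : V ≤ m * √V * √(2 * n) := h1.trans (by gcongr)
    have h4 : √V * √V ≤ √V * (m * √(2 * n)) := by
      rw [Real.mul_self_sqrt hV0]; linarith
    rcases (Real.sqrt_nonneg V).eq_or_lt with h0 | h0
    · have : V = 0 := by
        rw [← Real.sq_sqrt hV0, ← h0]; norm_num
      rw [this]; positivity
    · have h5 := le_of_mul_le_mul_left h4 h0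
      calc V = √V ^ 2 := (Real.sq_sqrt hV0).symm
        _ ≤ (m * √(2 * n)) ^ 2 := by gcongr
        _ = 2 * n * m ^ 2 := by rw [mul_pow, Real.sq_sqrt (by positivity)]; ring
  set γ : Fin n → ℝ := fun i => |α i - β i| with hγ
  have hγ2 : ∀ i, γ i ^ 2 ≤ (τ⁻¹) ^ 3 * (v i ^ 2 / g i) := by
    intro i
    have h1 : α i ^ 2 - β i ^ 2 = -(v i) * (α i ^ 2 * β i ^ 2) := by
      rw [hα2, hβ2]
      have := (ha0 i).ne'
      have := (hb0 i).ne'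
      field_simp
      simp only [ha, hb, hv]; ring
    -- From `|α - β| (α + β) = |α² - β²|`, dropping `α` from the sum. Four factors `α` survive: two
    -- absorb `g i`, since `α² ≤ 1 / (τ g i)`, and the rest are bounded by powers of `1 / τ`.
    have h2 : γ i ^ 2 * β i ^ 2 ≤ v i ^ 2 * (α i ^ 2 * β i ^ 2) ^ 2 := by
      calc γ i ^ 2 * β i ^ 2 ≤ γ i ^ 2 * (α i + β i) ^ 2 := by
            have := hα0 i
            have := hβ0 i
            gcongr
            linarith
        _ = (α i ^ 2 - β i ^ 2) ^ 2 := by simp only [hγ, sq_abs]; ring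
        _ = _ := by rw [h1]; ring
    have hβp : 0 < β i ^ 2 := pow_pos (hβ0 i) 2
    have h3 : γ i ^ 2 ≤ v i ^ 2 * (α i ^ 2 * α i ^ 2 * β i ^ 2) := by
      refine le_of_mul_le_mul_right (h2.trans (le_of_eq ?_)) hβp
      ring
    have h4 : α i ^ 2 ≤ τ⁻¹ / g i := by
      rw [le_div_iff₀ (hg0 i), mul_comm]; exact hαg i
    calc γ i ^ 2 ≤ v i ^ 2 * (α i ^ 2 * α i ^ 2 * β i ^ 2) := h3
      _ ≤ v i ^ 2 * (τ⁻¹ * (τ⁻¹ / g i) * τ⁻¹) := by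
          have := hατ i
          have := hβτ i
          have := (hg0 i).le
          have : 0 ≤ τ⁻¹ := (inv_pos.2 hτ).le
          gcongr
      _ = _ := by ring
  set Γ : ℝ := ∑ i, γ i ^ 2 with hΓ
  have hΓle : √Γ * √n ≤ 2 * n * m * κ ^ 3 := by
    rw [← Real.sqrt_mul (Finset.sum_nonneg fun i _ => sq_nonneg _)]
    refine Real.sqrt_le_iff.2 ⟨by positivity, ?_⟩
    have h1 : Γ ≤ (τ⁻¹) ^ 3 * (2 * n * m ^ 2) := by
      calc Γ ≤ ∑ i, (τ⁻¹) ^ 3 * (v i ^ 2 / g i) := Finset.sum_le_sum fun i _ => hγ2 i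
        _ = (τ⁻¹) ^ 3 * V := by rw [← Finset.mul_sum]
        _ ≤ _ := by gcongr
    calc Γ * n ≤ (τ⁻¹) ^ 3 * (2 * n * m ^ 2) * n := by gcongr
      _ = 2 * (n * m * κ ^ 3) ^ 2 := by rw [← hκ2]; ring
      _ ≤ 4 * (n * m * κ ^ 3) ^ 2 := by gcongr; norm_num
      _ = _ := by ring
  refine specNorm_le_of_bilin_le (by positivity) fun x y hx hy => ?_
  -- The first term changes the matrix under the random normalization; the second changes the
  -- normalization of the mean matrix, whose entries are at most `δ / n`.
  have hsplit : bilin (laplacian (regularize τ A) - laplacian (regularize τ p)) x y =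
      bilin (A - p) (fun i => α i * x i) (fun j => α j * y j) +
      ∑ i, ∑ j, (p i j + τ / n) * (α i * α j - β i * β j) * (x i * y j) := by
    simp only [bilin, ← Finset.sum_add_distrib, Matrix.sub_apply, laplacian_apply,
      degree_regularize hn, regularize_apply]
    refine Finset.sum_congr rfl fun i _ => Finset.sum_congr rfl fun j _ => ?_
    simp only [hα, hβ, ha, hb]
    ring
  have hw : ∀ u : Fin n → ℝ, ∑ i, u i ^ 2 ≤ 1 → √(∑ i, g i * (α i * u i) ^ 2) ≤ κ := by
    intro u hu
    refine Real.sqrt_le_iff.2 ⟨hκ0.le, ?_⟩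
    rw [hκ2]
    calc ∑ i, g i * (α i * u i) ^ 2 ≤ ∑ i, τ⁻¹ * u i ^ 2 := by
          refine Finset.sum_le_sum fun i _ => ?_
          rw [mul_pow, ← mul_assoc]
          exact mul_le_mul_of_nonneg_right (hαg i) (sq_nonneg _)
      _ = τ⁻¹ * ∑ i, u i ^ 2 := by rw [Finset.mul_sum]
      _ ≤ τ⁻¹ * 1 := by gcongr
      _ = τ⁻¹ := mul_one _
  have t1 : bilin (A - p) (fun i => α i * x i) (fun j => α j * y j) ≤ m / τ := by
    refine (hB _ _).trans ?_
    calc _ ≤ m * κ * κ := by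
          have := hw x hx
          have := hw y hy
          gcongr
      _ = m / τ := by rw [mul_assoc, ← sq, hκ2, div_eq_mul_inv]
  have hpt : ∀ i j, (p i j + τ / n) * (α i * α j - β i * β j) * (x i * y j) ≤
      δ / n * κ * ((|x i| * γ i) * |y j| + |x i| * (|y j| * γ j)) := by
    intro i j
    have hN0 : 0 ≤ p i j + τ / n := by have := hp0 i j; positivity
    have h1 : |α i * α j - β i * β j| ≤ κ * (γ i + γ j) := by
      have e : α i * α j - β i * β j = (α i - β i) * α j + β i * (α j - β j) := by ring
      rw [e]
      refine (abs_add_le _ _).trans ?_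
      rw [abs_mul, abs_mul, abs_of_pos (hα0 j), abs_of_pos (hβ0 i)]
      have h2 : |α i - β i| * α j ≤ |α i - β i| * κ :=
        mul_le_mul_of_nonneg_left (hακ j) (abs_nonneg _)
      have h3 : β i * |α j - β j| ≤ κ * |α j - β j| :=
        mul_le_mul_of_nonneg_right (hβκ i) (abs_nonneg _)
      simp only [hγ]
      linarith
    have hγ0 : ∀ i, 0 ≤ γ i := fun i => abs_nonneg _
    have := hγ0 i
    have := hγ0 j
    calc _ ≤ |(p i j + τ / n) * (α i * α j - β i * β j) * (x i * y j)| := le_abs_self _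
      _ = (p i j + τ / n) * |α i * α j - β i * β j| * (|x i| * |y j|) := by
          rw [abs_mul, abs_mul, abs_of_nonneg hN0, abs_mul (x i)]
      _ ≤ δ / n * (κ * (γ i + γ j)) * (|x i| * |y j|) := by
          have := hp i j
          gcongr
      _ = _ := by ring
  have cs1 : ∀ u : Fin n → ℝ, ∑ i, u i ^ 2 ≤ 1 → ∑ i, |u i| * γ i ≤ √Γ := by
    intro u hu
    refine (Real.sum_mul_le_sqrt_mul_sqrt _ _ _).trans ?_
    simp only [sq_abs]
    exact mul_le_of_le_one_left (Real.sqrt_nonneg _) (Real.sqrt_le_one.2 hu)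
  have cs2 : ∀ u : Fin n → ℝ, ∑ i, u i ^ 2 ≤ 1 → ∑ i, |u i| ≤ √n := by
    intro u hu
    have := Real.sum_mul_le_sqrt_mul_sqrt Finset.univ (fun i => |u i|) (fun _ => 1)
    simp only [sq_abs, mul_one, one_pow, Finset.sum_const, Finset.card_univ, Fintype.card_fin,
      nsmul_eq_mul] at this
    exact this.trans (mul_le_of_le_one_left (Real.sqrt_nonneg _) (Real.sqrt_le_one.2 hu))
  have t2 : ∑ i, ∑ j, (p i j + τ / n) * (α i * α j - β i * β j) * (x i * y j) ≤
      4 * δ * m / τ ^ 2 := by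
    calc _ ≤ ∑ i, ∑ j, δ / n * κ * ((|x i| * γ i) * |y j| + |x i| * (|y j| * γ j)) :=
          Finset.sum_le_sum fun i _ => Finset.sum_le_sum fun j _ => hpt i j
      _ = δ / n * κ * ((∑ i, |x i| * γ i) * (∑ j, |y j|) + (∑ i, |x i|) * ∑ j, |y j| * γ j) := by
          rw [Finset.sum_mul_sum, Finset.sum_mul_sum, ← Finset.sum_add_distrib, Finset.mul_sum]
          refine Finset.sum_congr rfl fun i _ => ?_
          rw [← Finset.sum_add_distrib, Finset.mul_sum]
      _ ≤ δ / n * κ * (√Γ * √n + √n * √Γ) := by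
          have hx1 := cs1 x hx
          have hy1 := cs1 y hy
          have hx2 := cs2 x hx
          have hy2 := cs2 y hy
          have hγ0 : ∀ i, 0 ≤ γ i := fun i => abs_nonneg _
          refine mul_le_mul_of_nonneg_left (add_le_add ?_ ?_) (by positivity)
          · exact mul_le_mul hx1 hy2 (Finset.sum_nonneg fun _ _ => abs_nonneg _)
              (Real.sqrt_nonneg _)
          · exact mul_le_mul hx2 hy1 (Finset.sum_nonneg fun i _ =>
              mul_nonneg (abs_nonneg _) (hγ0 i)) (Real.sqrt_nonneg _)
      _ = δ / n * κ * (2 * (√Γ * √n)) := by ring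
      _ ≤ δ / n * κ * (2 * (2 * n * m * κ ^ 3)) := by gcongr
      _ = 4 * δ * m * (κ ^ 2) ^ 2 := by field_simp; ring
      _ = _ := by rw [hκ2]; field_simp
  rw [hsplit]
  linarith

end Deterministic

/-! ### Choice of parameters and conclusion. -/

namespace IsInhomogeneousER

variable {Ω : Type*} [MeasurableSpace Ω] {μ : Measure Ω} [IsProbabilityMeasure μ] {n : ℕ}
  {p : Matrix (Fin n) (Fin n) ℝ} {A : Ω → Matrix (Fin n) (Fin n) ℝ}

lemma expectation_regularize (hA : IsInhomogeneousER μ p A) (τ : ℝ) :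
    (expectation μ fun ω => regularize τ (A ω)) = regularize τ p := by
  ext i j
  simp only [expectation, Matrix.of_apply, regularize_apply]
  rw [integral_add (hA.integrable_entry i j) (integrable_const _), hA.integral_entry]
  simp

end IsInhomogeneousER

lemma le_maxDeg {n : ℕ} (p : Matrix (Fin n) (Fin n) ℝ) (i j : Fin n) :
    (n : ℝ) * p i j ≤ maxDeg p :=
  le_ciSup (f := fun e : Fin n × Fin n => (n : ℝ) * p e.1 e.2) (Set.finite_range _).bddAbove (i, j)

/-- For `τ ≥ 1` the bound holds on the event that the two structural estimates hold. -/
lemma specNorm_le_of_structure {n : ℕ} (hn : 1 ≤ n) {h : ℕ} {r τ d : ℝ} (hr : 1 ≤ r)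
    (hτ : 1 ≤ τ) (hd0 : 0 ≤ d) (hh1 : d + τ ≤ 4 ^ h) (hh2 : (4 : ℝ) ^ h ≤ 4 * (d + τ))
    {A p : Matrix (Fin n) (Fin n) ℝ} (hA0 : ∀ i j, 0 ≤ A i j) (hAs : A.IsSymm)
    (hp0 : ∀ i j, 0 ≤ p i j) (hp : ∀ i j, n * p i j ≤ d)
    (hd : Discrepancy h (r + 4) A) (hl : LightBound h (8 * (118 + r)) (A - p)) :
    specNorm (laplacian (regularize τ A) - laplacian (regularize τ p)) ≤
      36000 * r ^ 2 / √τ * (1 + d / τ) ^ (5 / 2 : ℝ) := by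
  have hn0 : (0 : ℝ) < n := by exact_mod_cast hn
  have hτ0 : 0 < τ := by linarith
  have hdeg : ∀ i, 0 ≤ degree A i := fun i => Finset.sum_nonneg fun j _ => hA0 i j
  have hp4 : ∀ i j, p i j ≤ 4 ^ h / n := fun i j => by
    rw [le_div_iff₀ hn0, mul_comm]; linarith [hp i j]
  have hD : τ ≤ 18 * r * 4 ^ h := by nlinarith
  have hD0 : 0 < 18 * r * (4 : ℝ) ^ h := by positivity
  have main := specNorm_laplacian_sub_le hn hτ0 (δ := d + τ)
    (m := 2 * (1800 * r * 2 ^ h)) (by positivity) (by positivity) hA0 hp0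
    (fun i j => by
      rw [← sub_nonneg]
      have : (d + τ) / n - (p i j + τ / n) = (d - n * p i j) / n := by field_simp; ring
      rw [this]
      exact div_nonneg (by linarith [hp i j]) hn0.le)
    (g := fun i => 1 + degree A i / (18 * r * 4 ^ h))
    (fun i => by linarith [div_nonneg (hdeg i) hD0.le])
    (fun i => by
      have : τ * (degree A i / (18 * r * 4 ^ h)) ≤ degree A i := by
        rw [mul_div_assoc', div_le_iff₀ hD0, mul_comm]
        exact mul_le_mul_of_nonneg_left hD (hdeg i)
      linarith)
    (sum_weights_le hn hr hd) (bilin_centered_le hn hr hA0 hAs hp0 hp4 hd hl)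
  refine main.trans ?_
  set s : ℝ := 1 + d / τ with hs
  have hs1 : 1 ≤ s := by have : 0 ≤ d / τ := by positivity
                         linarith
  have hsτ : d + τ = τ * s := by rw [hs]; field_simp; ring
  have h2h : (2 : ℝ) ^ h ≤ 2 * (√τ * √s) := by
    refine (pow_le_pow_iff_left₀ (by positivity) (by positivity) two_ne_zero).1 ?_
    rw [mul_pow, mul_pow, Real.sq_sqrt hτ0.le, Real.sq_sqrt (by linarith), ← hsτ, ← pow_mul,
      mul_comm h, pow_mul]
    norm_num
    exact hh2
  have hs52 : √s * s ≤ s ^ (5 / 2 : ℝ) := by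
    rw [Real.sqrt_eq_rpow]
    nth_rewrite 2 [← Real.rpow_one s]
    rw [← Real.rpow_add (by linarith)]
    exact Real.rpow_le_rpow_of_exponent_le hs1 (by norm_num)
  have hττ : √τ * √τ = τ := Real.mul_self_sqrt hτ0.le
  have hst : 0 < √τ := Real.sqrt_pos.2 hτ0
  have hrr : r ≤ r ^ 2 := by nlinarith
  calc 2 * (1800 * r * 2 ^ h) / τ + 4 * (d + τ) * (2 * (1800 * r * 2 ^ h)) / τ ^ 2
      = 3600 * r * 2 ^ h * (1 + 4 * s) / τ := by rw [hsτ]; field_simp; ring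
    _ ≤ 3600 * r * (2 * (√τ * √s)) * (5 * s) / τ := by
        gcongr
        linarith
    _ = 36000 * r / √τ * (√s * s) := by
        rw [div_mul_eq_mul_div, div_eq_div_iff hτ0.ne' hst.ne']
        nth_rewrite 3 [← hττ]
        ring
    _ ≤ 36000 * r ^ 2 / √τ * s ^ (5 / 2 : ℝ) := by gcongr

end RegLap

end

theorem mainTheorem2 :
    ∃ C : ℝ, 0 < C ∧
      ∀ (n : ℕ), 1 ≤ n →
      ∀ (Ω : Type*) [MeasurableSpace Ω] (μ : Measure Ω) [IsProbabilityMeasure μ]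
        (p : Matrix (Fin n) (Fin n) ℝ) (A : Ω → Matrix (Fin n) (Fin n) ℝ),
        RegLap.IsInhomogeneousER μ p A →
      ∀ τ : ℝ, 0 < τ → ∀ r : ℝ, 1 ≤ r →
        1 - Real.exp (-r) ≤
          μ.real {ω |
            RegLap.specNorm
                (RegLap.laplacian (RegLap.regularize τ (A ω)) -
                  RegLap.laplacian
                    (RegLap.expectation μ fun ω' => RegLap.regularize τ (A ω'))) ≤
              C * r ^ 2 / √τ * (1 + RegLap.maxDeg p / τ) ^ (5 / 2 : ℝ)} := by
  refine ⟨36000, by norm_num, fun n hn Ω _ μ _ p A hA τ hτ r hr => ?_⟩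
  rw [hA.expectation_regularize]
  have hn0 : (0 : ℝ) < n := by exact_mod_cast hn
  set d := RegLap.maxDeg p with hd
  have hd0 : 0 ≤ d := le_trans (mul_nonneg hn0.le (hA.prob_nonneg ⟨0, hn⟩ ⟨0, hn⟩))
    (RegLap.le_maxDeg p ⟨0, hn⟩ ⟨0, hn⟩)
  set good : Set Ω := {ω | RegLap.specNorm (RegLap.laplacian (RegLap.regularize τ (A ω)) -
    RegLap.laplacian (RegLap.regularize τ p)) ≤
      36000 * r ^ 2 / √τ * (1 + d / τ) ^ (5 / 2 : ℝ)} with hgood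
  -- For `τ < 1` the right side is at least 36000, while two normalized Laplacians differ by at most
  -- 2 in norm.
  rcases lt_or_ge τ 1 with hτ1 | hτ1
  · have huniv : good = Set.univ := by
      refine Set.eq_univ_of_forall fun ω => ?_
      have hnn : ∀ M : Matrix (Fin n) (Fin n) ℝ, (∀ i j, 0 ≤ M i j) →
          (∀ i j, 0 ≤ RegLap.regularize τ M i j) ∧
          ∀ i, 0 < RegLap.degree (RegLap.regularize τ M) i := by
        intro M hM
        refine ⟨fun i j => ?_, fun i => ?_⟩
        · rw [RegLap.regularize_apply]
          exact add_nonneg (hM i j) (by positivity)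
        · rw [RegLap.degree_regularize hn]
          exact add_pos_of_nonneg_of_pos (Finset.sum_nonneg fun j _ => hM i j) hτ
      have hsy : ∀ M : Matrix (Fin n) (Fin n) ℝ, M.IsSymm → (RegLap.regularize τ M).IsSymm := by
        intro M hM
        refine Matrix.IsSymm.ext fun i j => ?_
        rw [RegLap.regularize_apply, RegLap.regularize_apply, hM.apply]
      have h1 := hnn (A ω) (hA.entry_nonneg ω)
      have h2 := hnn p hA.prob_nonneg
      have h3 := RegLap.specNorm_laplacian_sub_le_two h1.1 (hsy _ (hA.symm ω)) h1.2 h2.1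
        (hsy _ (Matrix.IsSymm.ext fun i j => hA.prob_symm j i)) h2.2
      refine h3.trans ?_
      have hs1 : 1 ≤ 1 + d / τ := by
        have : 0 ≤ d / τ := by positivity
        linarith
      have h4 : 1 ≤ (1 + d / τ) ^ (5 / 2 : ℝ) := Real.one_le_rpow hs1 (by norm_num)
      have h5 : 36000 ≤ 36000 * r ^ 2 / √τ := by
        rw [le_div_iff₀ (Real.sqrt_pos.2 hτ)]
        have := Real.sqrt_le_one.2 hτ1.le
        nlinarith
      nlinarith
    rw [huniv, probReal_univ]
    linarith [Real.exp_pos (-r)]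
  -- The scale used is `h = k + 1`, so that `d + τ ≤ 4 ^ h ≤ 4 (d + τ)`.
  · obtain ⟨k, hk1, hk2⟩ := exists_nat_pow_near (x := d + τ) (y := (4 : ℝ)) (by linarith)
      (by norm_num)
    have hp4 : ∀ i j, p i j ≤ 4 ^ (k + 1) / n := fun i j => by
      rw [le_div_iff₀ hn0, mul_comm]; linarith [RegLap.le_maxDeg p i j]
    set E₁ : Set Ω := {ω | ¬ RegLap.LightBound (k + 1) (8 * (118 + r)) (A ω - p)} with hE₁
    set E₂ : Set Ω := {ω | ¬ RegLap.Discrepancy (k + 1) (r + 4) (A ω)} with hE₂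
    have hcover : Set.univ ⊆ good ∪ (E₁ ∪ E₂) := by
      intro ω _
      by_cases h1 : RegLap.LightBound (k + 1) (8 * (118 + r)) (A ω - p)
      · by_cases h2 : RegLap.Discrepancy (k + 1) (r + 4) (A ω)
        · exact Or.inl (RegLap.specNorm_le_of_structure hn hr hτ1 hd0 hk2.le
            (by rw [pow_succ]; linarith) (hA.entry_nonneg ω) (hA.symm ω) hA.prob_nonneg
            (RegLap.le_maxDeg p) h2 h1)
        · exact Or.inr (Or.inr h2)
      · exact Or.inr (Or.inl h1)
    have h1 : μ.real E₁ ≤ Real.exp (-r) / 2 := hA.measure_not_lightBound_le hn hp4 hr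
    have h2 : μ.real E₂ ≤ Real.exp (-r) / 2 := hA.measure_not_discrepancy_le hn hp4 hr
    have h3 : μ.real (Set.univ : Set Ω) ≤ μ.real (good ∪ (E₁ ∪ E₂)) :=
      measureReal_mono hcover (measure_ne_top _ _)
    rw [probReal_univ] at h3
    have h4 := measureReal_union_le (μ := μ) good (E₁ ∪ E₂)
    have h5 := measureReal_union_le (μ := μ) E₁ E₂
    linarith
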